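/- Let $X$ be a locally compact separable metric space, $\mu$ a nonnegative Radon measure on $X$ with $\mu(U)>0$ for every nonempty open $U\subset X$, and $(\mathcal E,\mathcal F)$ a regular symmetric Dirichlet form on $L_2(X,\mu)$ whose killing part in the Beurling--Deny decomposition is zero. Put $\mathcal C:=C_c(X)\cap\mathcal F$, and for $a,c\in\mathcal C$ let $\Gamma(a,c)$ be the mutual energy measure, the polarization of $\int\varphi\,d\Gamma(a)=\mathcal E(\varphi a,a)-\frac12\mathcal E(\varphi,a^2)$, $\varphi\in\mathcal C$. Let $\mathcal H$ be the Hilbert space obtained from $\mathcal C\otimes\mathcal C$ with $\langle a\otimes b,c\otimes d\rangle_{\mathcal H}=\int_X bd\,d\Gamma(a,c)$ by factoring out zero seminorm elements and completing. Let $\partial:L_2(X,\mu)\to\mathcal H$, with $\operatorname{dom}\partial=\mathcal F$, be the closure of $a\mapsto a\otimes\mathbf 1$, $a\in\mathcal C$ (where $a\otimes\mathbf 1\in\mathcal H$ is determined by $\langle a\otimes\mathbf 1,c\otimes d\rangle_{\mathcal H}=\int_X d\,d\Gamma(a,c)$ for all $c,d\in\mathcal C$), let $\partial^*$ be its adjoint,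 and let $L$ be the generator of $(\mathcal E,\mathcal F)$, i.e. the nonpositive self-adjoint operator with $\mathcal E(f,g)=-\langle f,Lg\rangle_{L_2(X,\mu)}$ for $f\in\mathcal F$, $g\in\operatorname{dom}L$. All these objects are complexified. On $\mathbb H:=L_2(X,\mu)\oplus\mathcal H$ define the Dirac operator by $\mathbb D(f,\omega):=(\partial^*\omega,\partial f)$ with $\operatorname{dom}\mathbb D:=\mathcal F\oplus\operatorname{dom}\partial^*$. Suppose that $L$ has pure point spectrum, in the sense that there are a family $(\lambda_j)_{j\in J}$ of positive numbers (for instance a sequence $0<\lambda_1\le\lambda_2\le\dots$) and an orthonormal family $(\varphi_j)_{j\in J}$ in $\operatorname{dom}L$ with $-L\varphi_j=\lambda_j\varphi_j$ such that \[-Lf=\sum_{j}\lambda_j\langle f,\varphi_j\rangle_{L_2(X,\mu)}\,\varphi_j,\qquad f\in\operatorname{dom}L;\] the kernel of $L$ is arbitrary, so zero may be an eigenvalue of $L$, possibly of infinite multiplicity. Then $\varphi_j\in\operatorname{dom}\partial$, the vectors \[v_j=\tfrac1{\sqrt2}\bigl(\varphi_j,\lambda_j^{-1/2}\partial\varphi_j\bigr),\qquad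 w_j=\tfrac1{\sqrt2}\bigl(\varphi_j,-\lambda_j^{-1/2}\partial\varphi_j\bigr),\qquad j\in J,\] together form an orthonormal system in $\operatorname{dom}\mathbb D$, they are eigenvectors, $\mathbb Dv_j=\lambda_j^{1/2}v_j$ and $\mathbb Dw_j=-\lambda_j^{1/2}w_j$, and \[\mathbb Dv=\sum_{j}\lambda_j^{1/2}\langle v,v_j\rangle_{\mathbb H}\,v_j-\sum_{j}\lambda_j^{1/2}\langle v,w_j\rangle_{\mathbb H}\,w_j,\qquad v\in\operatorname{dom}\mathbb D,\] where both series converge in $\mathbb H$. Moreover, zero may be an eigenvalue of $\mathbb D$ of infinite multiplicity: there are $X$, $\mu$, $(\mathcal E,\mathcal F)$ as above whose generator has pure point spectrum in this sense, with an infinite sequence $0<\lambda_1\le\lambda_2\le\dots$, such that $\ker\mathbb D$ is infinite dimensional. -/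

import Mathlib

open MeasureTheory Topology Filter
open scoped CompactlySupported ENNReal ComplexOrder

noncomputable section

/-- The semi-inner product on finitely supported families with positive semidefinite Gram matrix
`M`: the sesquilinear extension of `M`, conjugate linear in the first variable. -/
abbrev preInnerCoreOfMatrix {n : Type*} (M : Matrix n n ℂ) (hM : M.PosSemidef) :
    PreInnerProductSpace.Core ℂ (n →₀ ℂ) where
  inner x y := x.sum fun p z => y.sum fun q w => star z * M p q * w
  conj_inner_symm x y := by
    rw [Finsupp.sum_comm]
    simp only [map_finsuppSum]
    refine Finsupp.sum_congr fun p _ => Finsupp.sum_congr fun q _ => ?_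
    rw [← hM.isHermitian.apply p q]
    simp
    ring
  re_inner_nonneg x := (Complex.nonneg_iff.1 (hM.2 x)).1
  add_left x y z := by
    rw [Finsupp.sum_add_index'] <;> simp [← Finsupp.sum_add, add_mul]
  smul_left x y r := by
    rw [Finsupp.sum_smul_index] <;> simp [Finsupp.mul_sum, ← mul_assoc]

section DirichletForms

variable {X : Type*} [TopologicalSpace X] [MeasurableSpace X] [BorelSpace X]

/-- A symmetric Dirichlet form `(𝓔, 𝓕)` on the real Hilbert space `L²(X, μ)`: a nonnegative
definite symmetric bilinear form on a dense subspace which is closed (the domain is complete for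
`𝓔₁ = 𝓔 + ⟨·,·⟩`) and Markovian (the unit contraction operates). -/
structure DirichletForm (μ : Measure X) where
  /-- The domain `𝓕`. -/
  domain : Submodule ℝ (Lp ℝ 2 μ)
  /-- The form `𝓔`. -/
  form : domain →ₗ[ℝ] domain →ₗ[ℝ] ℝ
  dense_domain : Dense (domain : Set (Lp ℝ 2 μ))
  symm : ∀ u v, form u v = form v u
  nonneg : ∀ u, 0 ≤ form u u
  closed : ∀ u : ℕ → domain,
    (∀ ε > 0, ∃ N, ∀ m ≥ N, ∀ n ≥ N,
      form (u m - u n) (u m - u n) + ‖(u m : Lp ℝ 2 μ) - u n‖ ^ 2 < ε) →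
    ∃ v : domain, Tendsto
      (fun n => form (u n - v) (u n - v) + ‖(u n : Lp ℝ 2 μ) - v‖ ^ 2) atTop (𝓝 0)
  markov : ∀ (u : domain) (w : Lp ℝ 2 μ),
    (w =ᵐ[μ] fun x => min (max 0 ((u : Lp ℝ 2 μ) x)) 1) →
    ∃ hw : w ∈ domain, form ⟨w, hw⟩ ⟨w, hw⟩ ≤ form u u

/-- The class in `L²(X, μ)` of a compactly supported continuous function. -/
def ccToLp (μ : Measure X) [IsFiniteMeasureOnCompacts μ] : C_c(X, ℝ) →ₗ[ℝ] Lp ℝ 2 μ where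
  toFun f := (f.continuous.memLp_of_hasCompactSupport f.hasCompactSupport).toLp f
  map_add' _ _ := rfl
  map_smul' _ _ := rfl

/-- The inclusion `L²(X, μ; ℝ) → L²(X, μ; ℂ)`. -/
def lpOfReal (μ : Measure X) : Lp ℝ 2 μ →L[ℝ] Lp ℂ 2 μ :=
  Complex.ofRealCLM.compLpL 2 μ

namespace DirichletForm

variable {μ : Measure X} [IsFiniteMeasureOnCompacts μ] (E : DirichletForm μ)

/-- The space `𝓒 = C_c(X) ∩ 𝓕`. -/
def core : Submodule ℝ C_c(X, ℝ) := E.domain.comap (ccToLp μ)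

/-- The inclusion `𝓒 → 𝓕`. -/
def coreToDomain : E.core →ₗ[ℝ] E.domain :=
  ((ccToLp μ).comp E.core.subtype).codRestrict E.domain fun a => a.2

/-- The form is regular: `𝓒` is uniformly dense in `C_c(X)` and `𝓔₁`-dense in `𝓕`. -/
def IsRegular : Prop :=
  (∀ f : C_c(X, ℝ), ∀ ε > 0, ∃ g ∈ E.core, ∀ x, |f x - g x| < ε) ∧
  ∀ u : E.domain, ∀ ε > 0, ∃ g : E.core,
    E.form (u - E.coreToDomain g) (u - E.coreToDomain g)
      + ‖(u : Lp ℝ 2 μ) - E.coreToDomain g‖ ^ 2 < ε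

/-- A Beurling-Deny decomposition of `𝓔` on `𝓒`: a strongly local symmetric nonnegative definite
form `Ec`, a symmetric Radon measure `J` off the diagonal (the jump measure), and a Radon measure
`k` on `X` (the killing measure). -/
structure IsBeurlingDeny (Ec : E.core →ₗ[ℝ] E.core →ₗ[ℝ] ℝ) (J : Measure (X × X))
    (k : Measure X) : Prop where
  local_symm : ∀ u v, Ec u v = Ec v u
  local_nonneg : ∀ u, 0 ≤ Ec u u
  strongly_local : ∀ (u v : E.core) (U : Set X) (r : ℝ), IsOpen U →
    tsupport (v : C_c(X, ℝ)) ⊆ U → (∀ x ∈ U, (u : C_c(X, ℝ)) x = r) → Ec u v = 0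
  jump_symm : J.map Prod.swap = J
  jump_diagonal : J (Set.diagonal X) = 0
  jump_radon : ∀ K : Set (X × X), IsCompact K → Disjoint K (Set.diagonal X) → J K < ∞
  killing_radon : k.Regular
  jump_integrable : ∀ u v : E.core, Integrable (fun p : X × X =>
    ((u : C_c(X, ℝ)) p.1 - (u : C_c(X, ℝ)) p.2) *
      ((v : C_c(X, ℝ)) p.1 - (v : C_c(X, ℝ)) p.2)) J
  decomposition : ∀ u v : E.core,
    E.form (E.coreToDomain u) (E.coreToDomain v) = Ec u v
      + ∫ p : X × X, ((u : C_c(X, ℝ)) p.1 - (u : C_c(X, ℝ)) p.2) *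
          ((v : C_c(X, ℝ)) p.1 - (v : C_c(X, ℝ)) p.2) ∂J
      + ∫ x, (u : C_c(X, ℝ)) x * (v : C_c(X, ℝ)) x ∂k

/-- The killing part in the (unique) Beurling-Deny decomposition of `𝓔` is zero. -/
def HasNoKilling : Prop :=
  ∃ (Ec : E.core →ₗ[ℝ] E.core →ₗ[ℝ] ℝ) (J : Measure (X × X)), E.IsBeurlingDeny Ec J 0

open Classical in
/-- `𝓔(f, g)` for compactly supported continuous functions `f`, `g` that belong to `𝓕`
(and `0` otherwise). -/
def formCc (f g : C_c(X, ℝ)) : ℝ :=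
  if h : f ∈ E.core ∧ g ∈ E.core then
    E.form (E.coreToDomain ⟨f, h.1⟩) (E.coreToDomain ⟨g, h.2⟩) else 0

/-- The integral `∫ φ dΓ(a, c)` of `φ ∈ 𝓒` with respect to the mutual energy measure of
`a, c ∈ 𝓒`, i.e. the polarization of the defining identity
`∫ φ dΓ(a) = 𝓔(φ a, a) - 1/2 𝓔(φ, a²)` of the energy measure. As `𝓒` is an algebra, only values
of `𝓔` on `𝓒` enter. -/
def energyIntegral (φ a c : C_c(X, ℝ)) : ℝ :=
  (E.formCc (φ * a) c + E.formCc (φ * c) a - E.formCc φ (a * c)) / 2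

/-- The Gram matrix `⟨a ⊗ b, c ⊗ d⟩ = ∫ b d dΓ(a, c)` of the simple tensors, `a, b, c, d ∈ 𝓒`. -/
def gram : Matrix (E.core × E.core) (E.core × E.core) ℂ :=
  Matrix.of fun p q => (E.energyIntegral ((p.2 : C_c(X, ℝ)) * q.2) p.1 q.1 : ℂ)

open Classical in
/-- The same matrix. It is positive semidefinite for every Dirichlet form; the other branch never
occurs, it only makes the completion below a definition that needs no proof of this fact. -/
def gramPos : Matrix (E.core × E.core) (E.core × E.core) ℂ :=
  if E.gram.PosSemidef then E.gram else 0

theorem gramPos_posSemidef : E.gramPos.PosSemidef := by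
  unfold gramPos
  split_ifs with h
  · exact h
  · exact Matrix.PosSemidef.zero

/-- Finite formal complex linear combinations of simple tensors `a ⊗ b`, `a, b ∈ 𝓒`. The relations
of the (complexified) tensor product `𝓒 ⊗ 𝓒` hold up to vectors of zero seminorm, because the form
below is bilinear in the simple tensors, so that they hold in the completion. -/
def PreOneForm : Type _ := (E.core × E.core) →₀ ℂ

instance : AddCommGroup E.PreOneForm := inferInstanceAs (AddCommGroup (_ →₀ ℂ))

instance : Module ℂ E.PreOneForm := inferInstanceAs (Module ℂ (_ →₀ ℂ))

instance : PreInnerProductSpace.Core ℂ E.PreOneForm :=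
  preInnerCoreOfMatrix E.gramPos E.gramPos_posSemidef

instance : SeminormedAddCommGroup E.PreOneForm :=
  InnerProductSpace.Core.toSeminormedAddCommGroup (𝕜 := ℂ)

instance : InnerProductSpace ℂ E.PreOneForm := InnerProductSpace.ofCore _

/-- The complex Hilbert space `𝓗` of differential `1`-forms associated with `(𝓔, 𝓕)`: simple
tensors modulo zero seminorm vectors, completed. -/
abbrev OneForm : Type _ := UniformSpace.Completion E.PreOneForm

/-- The simple tensor `a ⊗ b` as an element of `𝓗`. -/
def tensor (a b : E.core) : E.OneForm :=
  UniformSpace.Completion.coe' (α := E.PreOneForm)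
    (Finsupp.single (a, b) 1 : (E.core × E.core) →₀ ℂ)

/-- `η = ∂a`, i.e. `η = a ⊗ 1`: the element of `𝓗` with `⟨c ⊗ d, η⟩ = ∫ d dΓ(c, a)` for all simple
tensors `c ⊗ d`. -/
def IsGradient (a : E.core) (η : E.OneForm) : Prop :=
  ∀ c d : E.core, inner ℂ (E.tensor c d) η = (E.energyIntegral d c a : ℂ)

/-- The operator `∂ : L²(X, μ) → 𝓗`: the closure of the complex linear extension of
`a ↦ a ⊗ 1`, `a ∈ 𝓒`. For a regular form without killing part it has domain `𝓕`. -/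
def grad : Lp ℂ 2 μ →ₗ.[ℂ] E.OneForm :=
  (Submodule.span ℂ {p : Lp ℂ 2 μ × E.OneForm |
    ∃ a : E.core, p.1 = lpOfReal μ (ccToLp μ a) ∧ E.IsGradient a p.2}
      ).topologicalClosure.toLinearPMap

/-- The adjoint `∂* : 𝓗 → L²(X, μ)`. -/
def gradAdjoint : E.OneForm →ₗ.[ℂ] Lp ℂ 2 μ := E.grad.adjoint

/-- The generator `L`, complexified: for real `g ∈ 𝓕` and `h ∈ L²(X, μ)`, `g ∈ dom L` and `L g = h`
if and only if `𝓔(f, g) = -⟨f, h⟩` for all `f ∈ 𝓕`. -/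
def generator : Lp ℂ 2 μ →ₗ.[ℂ] Lp ℂ 2 μ :=
  (Submodule.span ℂ {p : Lp ℂ 2 μ × Lp ℂ 2 μ |
    ∃ (g : E.domain) (h : Lp ℝ 2 μ),
      (∀ f : E.domain, E.form f g = -inner ℝ (f : Lp ℝ 2 μ) h) ∧
      p = (lpOfReal μ g, lpOfReal μ h)}).toLinearPMap

/-- The Dirac operator `𝔻 (f, ω) = (∂* ω, ∂ f)` on `L²(X, μ) ⊕ 𝓗`, with domain
`dom ∂ ⊕ dom ∂*`. -/
def dirac : WithLp 2 (Lp ℂ 2 μ × E.OneForm) →ₗ.[ℂ] WithLp 2 (Lp ℂ 2 μ × E.OneForm) where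
  domain := (E.grad.domain.prod E.gradAdjoint.domain).comap
    (WithLp.linearEquiv 2 ℂ (Lp ℂ 2 μ × E.OneForm)).toLinearMap
  toFun :=
    { toFun := fun v => WithLp.toLp 2
        (E.gradAdjoint ⟨(v : WithLp 2 (Lp ℂ 2 μ × E.OneForm)).snd, v.2.2⟩,
          E.grad ⟨(v : WithLp 2 (Lp ℂ 2 μ × E.OneForm)).fst, v.2.1⟩)
      map_add' := fun v w => congrArg (WithLp.toLp 2) (Prod.ext
        (E.gradAdjoint.map_add ⟨_, v.2.2⟩ ⟨_, w.2.2⟩) (E.grad.map_add ⟨_, v.2.1⟩ ⟨_, w.2.1⟩))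
      map_smul' := fun c v => congrArg (WithLp.toLp 2) (Prod.ext
        (E.gradAdjoint.map_smul c ⟨_, v.2.2⟩) (E.grad.map_smul c ⟨_, v.2.1⟩)) }

/-- `L` has pure point spectrum, with nonzero eigenvalues `λ j > 0` of `-L` (repeated according to
multiplicity), an orthonormal family `φ j` of corresponding eigenfunctions, and
`-L f = ∑ j, λ j ⟨f, φ j⟩ φ j` for `f ∈ dom L`. The kernel of `L` is arbitrary. -/
structure HasPurePointSpectrum {ι : Type*} (lam : ι → ℝ) (φ : ι → Lp ℂ 2 μ) : Prop where
  pos : ∀ j, 0 < lam j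
  orthonormal : Orthonormal ℂ φ
  eigen : ∀ j, ∃ h : φ j ∈ E.generator.domain,
    -E.generator ⟨φ j, h⟩ = (lam j : ℂ) • φ j
  hasSum : ∀ f : E.generator.domain,
    HasSum (fun j => ((lam j : ℂ) * inner ℂ (φ j) (f : Lp ℂ 2 μ)) • φ j) (-E.generator f)

end DirichletForm

end DirichletForms

end

open MeasureTheory Topology Filter
open scoped CompactlySupported ENNReal ComplexOrder

noncomputable section

/-! ### Resolvents of a closed form: existence, sub-Markov property, approximation of the energy. -/

namespace DirichletForm

variable {X : Type*} [MeasurableSpace X] {μ : Measure X}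
  (E : DirichletForm μ)

/-! Weakly, -L = ∂*∂, so the eigenvalue equation reads ⟨∂φ_j, ∂u⟩ = λ_j⟨φ_j, u⟩ for u in dom ∂.
Hence the vectors e_j = λ_j^{-1/2}∂φ_j are orthonormal, ∂*∂φ_j = λ_jφ_j, and 𝔻 multiplies (φ_j,
±e_j) by ±√λ_j. A vector orthogonal to all φ_j is orthogonal to the range of L and so lies in ker ∂.
It follows that ∂f = ∑⟨f, φ_j⟩∂φ_j, because ∂ is closed, and that ∂*ω = ∑⟨∂*ω, φ_j⟩φ_j, because ∂*ω
is orthogonal to ker ∂. Half sums and half differences of the two coefficient families, both square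
summable, give the two series. This Hilbert space argument is `LinearPMap.IsSpectralFamily` together
with `dirac_spectral`.

The larger task is to show that ∂ really is a closed operator on 𝓕 with ⟨∂u, ∂v⟩ = 𝓔(u, v). The
resolvents T = β(β - L)⁻¹ are sub-Markovian, and β⟨u - Tu, v⟩ tends to 𝓔(u, v). Polynomial
inequalities pushed through T show that 𝓒 is an algebra (`mul_mem_core`) and that the Gram matrix
defining 𝓗 is positive semidefinite (`gram_posSemidef`). Absence of killing gives 𝓔(ψ, b) → 0 for
cutoffs ψ increasing to one, so a ⊗ ψ converges to a ⊗ 1 and its norm squared is 𝓔(a, a)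
(`exists_isGradient`). Density of 𝓒 extends this to 𝓕 (`exists_derivative`).

For the infinite dimensional kernel, take ℓ²(ℤ) with jumps only between n and -1 - n: -L is 0 on
even and 2 on odd functions, and both spaces are infinite dimensional. -/

theorem form_isSymm : LinearMap.IsSymm E.form := ⟨fun u v => by simpa using E.symm u v⟩

theorem form_sq_le (u v : E.domain) : E.form u v ^ 2 ≤ E.form u u * E.form v v :=
  LinearMap.BilinForm.apply_sq_le_of_symm E.form E.nonneg E.form_isSymm u v

/-- The form domain, as a Hilbert space with the inner product `𝓔₁`. -/
def FormSpace : Type _ := E.domain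

namespace FormSpace

instance : AddCommGroup E.FormSpace := inferInstanceAs (AddCommGroup E.domain)

instance : Module ℝ E.FormSpace := inferInstanceAs (Module ℝ E.domain)

/-- The identification of the form domain with the Hilbert space it carries. -/
def ofDomain : E.domain ≃ₗ[ℝ] E.FormSpace := LinearEquiv.refl ℝ _

/-- The `𝓔₁` inner product on the form domain. -/
abbrev core : InnerProductSpace.Core ℝ E.FormSpace where
  inner u v := E.form ((ofDomain E).symm u) ((ofDomain E).symm v) +
    inner ℝ ((ofDomain E).symm u : Lp ℝ 2 μ) ((ofDomain E).symm v)
  conj_inner_symm u v := by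
    simp only [conj_trivial]
    rw [E.symm, real_inner_comm]
  re_inner_nonneg u := add_nonneg (E.nonneg _) real_inner_self_nonneg
  add_left u v w := by
    simp [inner_add_left]; ring
  smul_left u v r := by
    simp [inner_smul_left]; ring
  definite u h := by
    have h1 := E.nonneg ((ofDomain E).symm u)
    have h2 : 0 ≤ inner ℝ ((ofDomain E).symm u : Lp ℝ 2 μ) ((ofDomain E).symm u) :=
      real_inner_self_nonneg
    have h3 : inner ℝ ((ofDomain E).symm u : Lp ℝ 2 μ) ((ofDomain E).symm u) = 0 := by
      linarith
    simpa using h3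

instance : NormedAddCommGroup E.FormSpace :=
  (core E).toNormedAddCommGroup

instance : InnerProductSpace ℝ E.FormSpace := InnerProductSpace.ofCore (core E).toCore

theorem inner_def (u v : E.domain) : inner ℝ (ofDomain E u) (ofDomain E v) =
    E.form u v + inner ℝ (u : Lp ℝ 2 μ) v := rfl

theorem norm_sq (u : E.domain) : ‖ofDomain E u‖ ^ 2 = E.form u u + ‖(u : Lp ℝ 2 μ)‖ ^ 2 := by
  rw [← real_inner_self_eq_norm_sq, inner_def, real_inner_self_eq_norm_sq]

instance : CompleteSpace E.FormSpace := by
  refine Metric.complete_of_cauchySeq_tendsto fun u hu => ?_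
  obtain ⟨v, hv⟩ := E.closed (fun n => (ofDomain E).symm (u n)) fun ε hε => by
    obtain ⟨N, hN⟩ := Metric.cauchySeq_iff.1 hu (√ε) (Real.sqrt_pos.2 hε)
    refine ⟨N, fun m hm n hn => ?_⟩
    have := hN m hm n hn
    rw [dist_eq_norm, Real.lt_sqrt (norm_nonneg _)] at this
    have h2 := norm_sq E ((ofDomain E).symm (u m) - (ofDomain E).symm (u n))
    rw [← map_sub, LinearEquiv.apply_symm_apply, map_sub] at h2
    rw [h2] at this
    exact this
  refine ⟨ofDomain E v, ?_⟩
  rw [tendsto_iff_norm_sub_tendsto_zero]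
  have h3 : Tendsto (fun n => ‖u n - ofDomain E v‖ ^ 2) atTop (𝓝 0) := by
    refine hv.congr fun n => ?_
    have h2 := norm_sq E ((ofDomain E).symm (u n) - v)
    rw [map_sub, LinearEquiv.apply_symm_apply] at h2
    rw [h2]; rfl
  have h4 := h3.sqrt
  simpa using h4

/-- The inclusion of the form domain in `L²`. -/
def toLp : E.FormSpace →L[ℝ] Lp ℝ 2 μ :=
  (E.domain.subtype ∘ₗ (ofDomain E).symm.toLinearMap).mkContinuous 1 fun u => by
    have h := norm_sq E ((ofDomain E).symm u)
    rw [LinearEquiv.apply_symm_apply] at h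
    have h1 := E.nonneg ((ofDomain E).symm u)
    rw [one_mul]
    refine (sq_le_sq₀ (norm_nonneg _) (norm_nonneg _)).1 ?_
    rw [h]
    simpa using h1

end FormSpace

/-- `T` is the resolvent `β (β - L)⁻¹` of the form. -/
def IsResolvent (β : ℝ) (T : Lp ℝ 2 μ →ₗ[ℝ] E.domain) : Prop :=
  ∀ u (v : E.domain), E.form (T u) v = β * inner ℝ (u - T u : Lp ℝ 2 μ) (v : Lp ℝ 2 μ)

/-- Riesz representation: `T` is the adjoint of the inclusion of (𝓕, 𝓔₁) in L², so that 𝓔(Tu, v) +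
⟨Tu, v⟩ = ⟨u, v⟩. -/
theorem exists_isResolvent_one : ∃ T, E.IsResolvent 1 T := by
  refine ⟨(FormSpace.ofDomain E).symm.toLinearMap ∘ₗ
    (ContinuousLinearMap.adjoint (FormSpace.toLp E)).toLinearMap, fun u v => ?_⟩
  have h := ContinuousLinearMap.adjoint_inner_left (FormSpace.toLp E) (FormSpace.ofDomain E v) u
  obtain ⟨w, hw⟩ := (FormSpace.ofDomain E).surjective
    (ContinuousLinearMap.adjoint (FormSpace.toLp E) u)
  rw [← hw, FormSpace.inner_def] at h
  have h2 : FormSpace.toLp E (FormSpace.ofDomain E v) = v := rfl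
  rw [h2] at h
  simp only [LinearMap.comp_apply, ContinuousLinearMap.coe_coe, ← hw, LinearEquiv.coe_coe,
    LinearEquiv.symm_apply_apply, inner_sub_left]
  linarith

/-- The form `c 𝓔`, `c > 0`. -/
def scale (c : ℝ) (hc : 0 < c) : DirichletForm μ where
  domain := E.domain
  form := c • E.form
  dense_domain := E.dense_domain
  symm u v := by simp [E.symm u v]
  nonneg u := mul_nonneg hc.le (E.nonneg u)
  closed u hu := by
    obtain ⟨v, hv⟩ := E.closed u fun ε hε => by
      -- The two norms are equivalent: min(c, 1)(𝓔 + ‖·‖²) ≤ c𝓔 + ‖·‖² ≤ (c + 1)(𝓔 + ‖·‖²).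
      obtain ⟨N, hN⟩ := hu (ε * min c 1) (by positivity)
      refine ⟨N, fun m hm n hn => ?_⟩
      have := hN m hm n hn
      simp only [LinearMap.smul_apply, smul_eq_mul] at this
      have h1 := E.nonneg (u m - u n)
      have h2 := sq_nonneg ‖(u m : Lp ℝ 2 μ) - u n‖
      have h3 : 0 < min c 1 := by positivity
      refine lt_of_mul_lt_mul_right (lt_of_le_of_lt ?_ this) h3.le
      nlinarith [min_le_left c 1, min_le_right c 1]
    refine ⟨v, ?_⟩
    have h := hv.const_mul (c + 1)
    rw [mul_zero] at h
    refine squeeze_zero (fun n => ?_) (fun n => ?_) h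
    · exact add_nonneg (mul_nonneg hc.le (E.nonneg _)) (sq_nonneg _)
    · have h1 := E.nonneg (u n - v)
      have h2 := sq_nonneg ‖(u n : Lp ℝ 2 μ) - v‖
      simp only [LinearMap.smul_apply, smul_eq_mul]
      nlinarith
  markov u w hw := by
    obtain ⟨h, h'⟩ := E.markov u w hw
    exact ⟨h, mul_le_mul_of_nonneg_left h' hc.le⟩

/-- The parameter is absorbed into the form: use the resolvent at 1 of β⁻¹𝓔. -/
theorem exists_isResolvent {β : ℝ} (hβ : 0 < β) : ∃ T, E.IsResolvent β T := by
  obtain ⟨T, hT⟩ := (E.scale β⁻¹ (inv_pos.2 hβ)).exists_isResolvent_one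
  refine ⟨T, fun u v => ?_⟩
  have h : β⁻¹ * E.form (T u) v = 1 * inner ℝ (u - T u : Lp ℝ 2 μ) (v : Lp ℝ 2 μ) := hT u v
  exact (inv_mul_eq_iff_eq_mul₀ hβ.ne').1 (h.trans (one_mul _))

variable {E}

namespace IsResolvent

variable {β : ℝ} {T : Lp ℝ 2 μ →ₗ[ℝ] E.domain}

theorem inner_comm (hT : E.IsResolvent β T) (hβ : 0 < β) (u v : Lp ℝ 2 μ) :
    inner ℝ (T u : Lp ℝ 2 μ) v = inner ℝ u (T v : Lp ℝ 2 μ) := by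
  have h1 := hT u (T v)
  have h2 := hT v (T u)
  rw [E.symm, h2] at h1
  have h3 := mul_left_cancel₀ hβ.ne' h1
  rw [inner_sub_left, inner_sub_left, real_inner_comm (T u : Lp ℝ 2 μ) (T v : Lp ℝ 2 μ),
    real_inner_comm (T u : Lp ℝ 2 μ) v] at h3
  linarith

/-- `T f` is the unique minimizer of 𝓔(w, w) + β‖w - f‖². Expanding around `T f`, the linear terms
cancel by the resolvent equation. -/
theorem eq_of_le (hT : E.IsResolvent β T) (hβ : 0 < β) (f : Lp ℝ 2 μ) (w : E.domain)
    (h1 : E.form w w ≤ E.form (T f) (T f))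
    (h2 : ‖(w : Lp ℝ 2 μ) - f‖ ≤ ‖(T f : Lp ℝ 2 μ) - f‖) : w = T f := by
  have h3 := hT f (w - T f)
  have h4 := E.nonneg (w - T f)
  have h5 : E.form w w = E.form (T f) (T f) + 2 * E.form (T f) (w - T f)
      + E.form (w - T f) (w - T f) := by
    simp only [map_sub, LinearMap.sub_apply]
    rw [E.symm w (T f)]; ring
  have h6 : ‖(w : Lp ℝ 2 μ) - f‖ ^ 2 = ‖(T f : Lp ℝ 2 μ) - f‖ ^ 2
      - 2 * inner ℝ (f - T f : Lp ℝ 2 μ) ((w - T f : E.domain) : Lp ℝ 2 μ)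
      + ‖(w - T f : Lp ℝ 2 μ)‖ ^ 2 := by
    have : (w : Lp ℝ 2 μ) - f = (w - T f : Lp ℝ 2 μ) - (f - T f : Lp ℝ 2 μ) := by abel
    rw [this, norm_sub_sq_real, norm_sub_rev (T f : Lp ℝ 2 μ) f,
      real_inner_comm (f - T f : Lp ℝ 2 μ)]
    simp only [Submodule.coe_sub]
    ring
  have h7 : ‖(w : Lp ℝ 2 μ) - f‖ ^ 2 ≤ ‖(T f : Lp ℝ 2 μ) - f‖ ^ 2 := by gcongr
  have h8 : ‖(w - T f : Lp ℝ 2 μ)‖ ^ 2 ≤ 0 := by nlinarith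
  have h9 : ‖(w - T f : Lp ℝ 2 μ)‖ = 0 := by nlinarith [norm_nonneg (w - T f : Lp ℝ 2 μ)]
  exact Subtype.ext (sub_eq_zero.1 (norm_eq_zero.1 h9))

/-- Clipping `T f` to [0, 1] lowers its energy and, as f takes values in [0, 1], moves it no further
from f. Uniqueness of the minimizer forces the clipped function to be `T f`. -/
theorem mem_unit (hT : E.IsResolvent β T) (hβ : 0 < β) {f : Lp ℝ 2 μ}
    (h0 : ∀ᵐ x ∂μ, 0 ≤ f x) (h1 : ∀ᵐ x ∂μ, f x ≤ 1) :
    (∀ᵐ x ∂μ, 0 ≤ (T f : Lp ℝ 2 μ) x) ∧ ∀ᵐ x ∂μ, (T f : Lp ℝ 2 μ) x ≤ 1 := by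
  set v : Lp ℝ 2 μ := (T f : Lp ℝ 2 μ) with hv
  have hm : MemLp (fun x => min (max 0 (v x)) 1) 2 μ := by
    refine (Lp.memLp v).of_le ?_ ?_
    · exact (continuous_const.max continuous_id |>.min continuous_const).comp_aestronglyMeasurable
        (Lp.aestronglyMeasurable v)
    · refine ae_of_all _ fun x => ?_
      rw [Real.norm_of_nonneg (by positivity)]
      exact (min_le_left _ _).trans (max_le (norm_nonneg _) (le_abs_self _))
  have hw := hm.coeFn_toLp
  obtain ⟨hd, hle⟩ := E.markov (T f) (hm.toLp _) hw
  have key := hT.eq_of_le hβ f ⟨_, hd⟩ hle (by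
    refine Lp.norm_le_norm_of_ae_le ?_
    filter_upwards [Lp.coeFn_sub (hm.toLp _) f, Lp.coeFn_sub v f, hw, h0, h1]
      with x e1 e2 e3 e4 e5
    rw [← hv, e1, e2, Pi.sub_apply, Pi.sub_apply, e3, Real.norm_eq_abs, Real.norm_eq_abs]
    rcases le_total (v x) 0 with h | h
    · rw [max_eq_left h, min_eq_left zero_le_one, abs_of_nonpos (by linarith),
        abs_of_nonpos (by linarith)]; linarith
    · rw [max_eq_right h]
      rcases le_total (v x) 1 with h' | h'
      · rw [min_eq_left h']
      · rw [min_eq_right h', abs_of_nonneg (by linarith), abs_of_nonneg (by linarith)]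
        linarith)
  have key' : (hm.toLp _ : Lp ℝ 2 μ) = v := congrArg Subtype.val key
  rw [key'] at hw
  constructor
  · filter_upwards [hw] with x hx
    rw [hx]; positivity
  · filter_upwards [hw] with x hx
    rw [hx]; exact min_le_right _ _

theorem nonneg_le (hT : E.IsResolvent β T) (hβ : 0 < β) {f : Lp ℝ 2 μ} {κ : ℝ} (hκ : 0 < κ)
    (h0 : ∀ᵐ x ∂μ, 0 ≤ f x) (h1 : ∀ᵐ x ∂μ, f x ≤ κ) :
    (∀ᵐ x ∂μ, 0 ≤ (T f : Lp ℝ 2 μ) x) ∧ ∀ᵐ x ∂μ, (T f : Lp ℝ 2 μ) x ≤ κ := by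
  have hs := Lp.coeFn_smul κ⁻¹ f
  obtain ⟨h2, h3⟩ := hT.mem_unit hβ (f := κ⁻¹ • f)
    (by filter_upwards [hs, h0] with x e1 e2
        rw [e1, Pi.smul_apply, smul_eq_mul]; positivity)
    (by filter_upwards [hs, h1] with x e1 e2
        rw [e1, Pi.smul_apply, smul_eq_mul]
        exact (inv_mul_le_one₀ hκ).2 e2)
  rw [map_smul, Submodule.coe_smul] at h2 h3
  have hs' := Lp.coeFn_smul κ⁻¹ (T f : Lp ℝ 2 μ)
  constructor
  · filter_upwards [h2, hs'] with x e1 e2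
    rw [e2, Pi.smul_apply, smul_eq_mul] at e1
    exact (mul_nonneg_iff_of_pos_left (inv_pos.2 hκ)).1 e1
  · filter_upwards [h3, hs'] with x e1 e2
    rw [e2, Pi.smul_apply, smul_eq_mul] at e1
    exact (inv_mul_le_one₀ hκ).1 e1

/-- Energies of resolvents increase with the parameter, with a quantitative gap: a bounded family of
them is then 𝓔-Cauchy. It suffices that 𝓔(Tu, d) ≥ 0 for the difference d. -/
theorem form_sub_le (hT : E.IsResolvent β T) {γ : ℝ} {S : Lp ℝ 2 μ →ₗ[ℝ] E.domain}
    (hS : E.IsResolvent γ S) (hβ : 0 < β) (h : β ≤ γ) (u : Lp ℝ 2 μ) :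
    E.form (S u - T u) (S u - T u) ≤ E.form (S u) (S u) - E.form (T u) (T u) := by
  set d := S u - T u with hd
  have e1 := hS u d
  have e2 := hT u d
  have e3 : E.form d d = E.form (S u) d - E.form (T u) d := by
    rw [← LinearMap.sub_apply, ← map_sub, ← hd]
  have e4 : inner ℝ (u - S u : Lp ℝ 2 μ) (d : Lp ℝ 2 μ) =
      inner ℝ (u - T u : Lp ℝ 2 μ) (d : Lp ℝ 2 μ) - ‖(d : Lp ℝ 2 μ)‖ ^ 2 := by
    rw [← real_inner_self_eq_norm_sq, ← inner_sub_left]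
    congr 1
    rw [hd, Submodule.coe_sub]; abel
  have e5 : E.form (S u) (S u) = E.form (T u) (T u) + 2 * E.form (T u) d + E.form d d := by
    rw [hd]
    simp only [map_sub, LinearMap.sub_apply]
    rw [E.symm (S u) (T u)]; ring
  have e6 := E.nonneg d
  -- Subtracting the resolvent equations gives 0 ≤ 𝓔(d, d) = (γ - β)⟨u - Tu, d⟩ - γ‖d‖²; a negative
  -- inner product would force d = 0.
  have e7 : 0 ≤ inner ℝ (u - T u : Lp ℝ 2 μ) (d : Lp ℝ 2 μ) := by
    by_contra! hneg
    rw [e4] at e1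
    have h1 : ‖(d : Lp ℝ 2 μ)‖ ^ 2 ≤ 0 := by
      have := mul_nonpos_of_nonneg_of_nonpos (sub_nonneg.2 h) hneg.le
      have : γ * ‖(d : Lp ℝ 2 μ)‖ ^ 2 ≤ 0 := by linarith
      exact nonpos_of_mul_nonpos_right this (hβ.trans_le h)
    have h2 : (d : Lp ℝ 2 μ) = 0 :=
      norm_eq_zero.1 (pow_eq_zero_iff two_ne_zero |>.1 (le_antisymm h1 (sq_nonneg _)))
    rw [h2, inner_zero_right] at hneg
    exact hneg.false
  have e8 : 0 ≤ E.form (T u) d := by rw [e2]; exact mul_nonneg hβ.le e7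
  linarith

theorem form_self (hT : E.IsResolvent β T) (u : Lp ℝ 2 μ) :
    E.form (T u) (T u) + β * ‖(u - T u : Lp ℝ 2 μ)‖ ^ 2 =
      β * inner ℝ (u - T u : Lp ℝ 2 μ) u := by
  rw [hT u (T u), ← real_inner_self_eq_norm_sq, ← mul_add, ← inner_add_right]
  congr 2; abel

/-- Expand 𝓔(u - Tu, u - Tu) ≥ 0 and evaluate both remaining terms by the resolvent equation. -/
theorem inner_le_form (hT : E.IsResolvent β T) (hβ : 0 < β) (u : E.domain) :
    β * inner ℝ ((u : Lp ℝ 2 μ) - T u) (u : Lp ℝ 2 μ) ≤ E.form u u := by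
  have h1 := hT.form_self (u : Lp ℝ 2 μ)
  have h2 := hT (u : Lp ℝ 2 μ) u
  have h3 := E.nonneg (u - T u)
  simp only [map_sub, LinearMap.sub_apply] at h3
  rw [E.symm u (T u)] at h3
  nlinarith [mul_nonneg hβ.le (sq_nonneg ‖((u : Lp ℝ 2 μ) - T u : Lp ℝ 2 μ)‖)]

end IsResolvent

/-- A function in `L²` whose approximate energies are bounded belongs to the domain. -/
theorem exists_mem_domain_of_bounded {T : ℕ → Lp ℝ 2 μ →ₗ[ℝ] E.domain}
    (hT : ∀ n : ℕ, E.IsResolvent (n + 1) (T n)) (u : Lp ℝ 2 μ) (K : ℝ)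
    (hK : ∀ n : ℕ, (n + 1) * inner ℝ (u - T n u : Lp ℝ 2 μ) u ≤ K) :
    ∃ v : E.domain, (v : Lp ℝ 2 μ) = u ∧
      Tendsto (fun n => E.form (T n u - v) (T n u - v)) atTop (𝓝 0) := by
  have hpos : ∀ n : ℕ, (0 : ℝ) < n + 1 := fun n => by positivity
  have hb : ∀ n, E.form (T n u) (T n u) ≤ K := fun n => by
    have := (hT n).form_self u
    nlinarith [hK n, mul_nonneg (hpos n).le (sq_nonneg ‖(u - T n u : Lp ℝ 2 μ)‖)]
  -- The energies of `T n u` are increasing and bounded by K, hence convergent; this bound turns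
  -- that into an 𝓔-Cauchy property, and closedness of the form supplies the limit.
  have hd : ∀ m n, m ≤ n → E.form (T n u - T m u) (T n u - T m u) ≤
      E.form (T n u) (T n u) - E.form (T m u) (T m u) := fun m n hmn =>
    (hT m).form_sub_le (hT n) (hpos m) (by gcongr) u
  have hmono : Monotone fun n => E.form (T n u) (T n u) := fun m n hmn => by
    have := hd m n hmn
    have := E.nonneg (T n u - T m u)
    simp only
    linarith
  have hlim := tendsto_atTop_ciSup hmono ⟨K, by rintro _ ⟨n, rfl⟩; exact hb n⟩
  have hL2 : Tendsto (fun n => (T n u : Lp ℝ 2 μ)) atTop (𝓝 u) := by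
    rw [tendsto_iff_norm_sub_tendsto_zero]
    have h1 : Tendsto (fun n => ‖(T n u : Lp ℝ 2 μ) - u‖ ^ 2) atTop (𝓝 0) := by
      refine squeeze_zero (fun n => sq_nonneg _) (fun n => ?_)
        ((tendsto_one_div_add_atTop_nhds_zero_nat (𝕜 := ℝ)).const_mul K |>.trans
          (by rw [mul_zero]))
      rw [mul_one_div, le_div_iff₀ (hpos n), norm_sub_rev]
      have := (hT n).form_self u
      linarith [hK n, E.nonneg (T n u)]
    simpa using h1.sqrt
  obtain ⟨v, hv⟩ := E.closed (fun n => T n u) fun ε hε => by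
    obtain ⟨N1, h1⟩ := Metric.cauchySeq_iff.1 hlim.cauchySeq (ε / 2) (half_pos hε)
    obtain ⟨N2, h2⟩ := Metric.cauchySeq_iff.1 hL2.cauchySeq (√(ε / 2))
      (Real.sqrt_pos.2 (half_pos hε))
    have main : ∀ m ≥ max N1 N2, ∀ n ≥ max N1 N2, E.form (T m u - T n u) (T m u - T n u) < ε / 2 := by
      have : ∀ m ≥ max N1 N2, ∀ n ≥ max N1 N2, m ≤ n →
          E.form (T n u - T m u) (T n u - T m u) < ε / 2 := fun m hm n hn hmn =>
        (hd m n hmn).trans_lt ((le_abs_self _).trans_lt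
          (h1 n (le_of_max_le_left hn) m (le_of_max_le_left hm)))
      intro m hm n hn
      rcases le_total m n with h | h
      · rw [← neg_sub, map_neg, map_neg, LinearMap.neg_apply, neg_neg]
        exact this m hm n hn h
      · exact this n hn m hm h
    refine ⟨max N1 N2, fun m hm n hn => ?_⟩
    have h3 := h2 m (le_of_max_le_right hm) n (le_of_max_le_right hn)
    rw [dist_eq_norm, Real.lt_sqrt (norm_nonneg _)] at h3
    linarith [main m hm n hn]
  have hv1 : Tendsto (fun n => E.form (T n u - v) (T n u - v)) atTop (𝓝 0) :=
    squeeze_zero (fun n => E.nonneg _) (fun n => by linarith [sq_nonneg ‖(T n u : Lp ℝ 2 μ) - v‖]) hv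
  have hv2 : Tendsto (fun n => ‖(T n u : Lp ℝ 2 μ) - v‖ ^ 2) atTop (𝓝 0) :=
    squeeze_zero (fun n => sq_nonneg _) (fun n => by linarith [E.nonneg (T n u - v)]) hv
  refine ⟨v, ?_, hv1⟩
  refine tendsto_nhds_unique ?_ hL2
  rw [tendsto_iff_norm_sub_tendsto_zero]
  simpa using hv2.sqrt

variable (E) in
theorem exists_resolvents : ∃ T : ℕ → Lp ℝ 2 μ →ₗ[ℝ] E.domain,
    ∀ n : ℕ, E.IsResolvent (n + 1) (T n) :=
  ⟨fun n => (E.exists_isResolvent (β := n + 1) (by positivity)).choose,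
    fun n => (E.exists_isResolvent (β := n + 1) (by positivity)).choose_spec⟩

/-- The approximate energies converge to the energy. -/
theorem tendsto_resolvent_inner {T : ℕ → Lp ℝ 2 μ →ₗ[ℝ] E.domain}
    (hT : ∀ n : ℕ, E.IsResolvent (n + 1) (T n)) (u v : E.domain) :
    Tendsto (fun n : ℕ => ((n : ℝ) + 1) * inner ℝ ((u : Lp ℝ 2 μ) - T n u) (v : Lp ℝ 2 μ)) atTop
      (𝓝 (E.form u v)) := by
  obtain ⟨w, hw, hlim⟩ := exists_mem_domain_of_bounded hT (u : Lp ℝ 2 μ) (E.form u u)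
    fun n => (hT n).inner_le_form (by positivity) u
  obtain rfl : w = u := Subtype.ext hw
  rw [tendsto_iff_norm_sub_tendsto_zero]
  have h2 := (hlim.mul_const (E.form v v)).sqrt
  rw [zero_mul, Real.sqrt_zero] at h2
  refine squeeze_zero (fun n => norm_nonneg _) (fun n => ?_) h2
  refine Real.abs_le_sqrt ?_
  rw [← hT n w v, ← LinearMap.sub_apply, ← map_sub]
  exact E.form_sq_le _ _

end DirichletForm

/-! ### Almost everywhere statements and compactly supported functions. -/

section

variable {X : Type*} [MeasurableSpace X] {μ : Measure X}

/-- One null set serves a countable dense set of parameters, and continuity covers the rest. This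
later allows the parameter to depend on the point x. -/
theorem ae_forall_nonneg_of_continuous {Θ : Type*} [TopologicalSpace Θ]
    [TopologicalSpace.SeparableSpace Θ] {F : Θ → X → ℝ} (hc : ∀ x, Continuous fun θ => F θ x)
    (h : ∀ θ, ∀ᵐ x ∂μ, 0 ≤ F θ x) : ∀ᵐ x ∂μ, ∀ θ, 0 ≤ F θ x := by
  obtain ⟨s, hs, hd⟩ := TopologicalSpace.exists_countable_dense Θ
  filter_upwards [(ae_ball_iff hs).2 fun θ _ => h θ] with x hx θ
  have h1 : IsClosed {θ | 0 ≤ F θ x} := isClosed_le continuous_const (hc x)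
  exact h1.closure_subset_iff.2 (fun θ hθ => hx θ hθ) (hd θ)

theorem coeFn_sum_smul {ι : Type*} (s : Finset ι) (c : ι → ℝ) (U : ι → Lp ℝ 2 μ) :
    ((∑ i ∈ s, c i • U i : Lp ℝ 2 μ) : X → ℝ) =ᵐ[μ] fun x => ∑ i ∈ s, c i * U i x := by
  classical
  induction s using Finset.induction_on with
  | empty =>
    filter_upwards [Lp.coeFn_zero ℝ 2 μ] with x hx
    simpa using hx
  | insert i s hi ih =>
    rw [Finset.sum_insert hi]
    filter_upwards [ih, Lp.coeFn_add (c i • U i) (∑ i ∈ s, c i • U i), Lp.coeFn_smul (c i) (U i)]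
      with x h1 h2 h3
    rw [h2, Pi.add_apply, h3, h1, Finset.sum_insert hi, Pi.smul_apply, smul_eq_mul]

theorem integral_sub_sub_add {f₁ f₂ f₃ f₄ : X → ℝ} (h₁ : Integrable f₁ μ) (h₂ : Integrable f₂ μ)
    (h₃ : Integrable f₃ μ) (h₄ : Integrable f₄ μ) :
    ∫ x, f₁ x - f₂ x - f₃ x + f₄ x ∂μ =
      (∫ x, f₁ x ∂μ) - (∫ x, f₂ x ∂μ) - (∫ x, f₃ x ∂μ) + ∫ x, f₄ x ∂μ := by
  have h := integral_add ((h₁.sub h₂).sub h₃) h₄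
  have h' := integral_sub (h₁.sub h₂) h₃
  simp only [Pi.sub_apply] at h h'
  rw [h, h', integral_sub h₁ h₂]

variable [TopologicalSpace X] [BorelSpace X] [IsFiniteMeasureOnCompacts μ]

theorem coeFn_ccToLp (f : C_c(X, ℝ)) : ccToLp μ f =ᵐ[μ] f :=
  (f.continuous.memLp_of_hasCompactSupport f.hasCompactSupport).coeFn_toLp

theorem inner_ccToLp_left (f : C_c(X, ℝ)) (u : Lp ℝ 2 μ) :
    inner ℝ (ccToLp μ f) u = ∫ x, f x * u x ∂μ := by
  rw [L2.inner_def]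
  refine integral_congr_ae ?_
  filter_upwards [coeFn_ccToLp (μ := μ) f] with x hx
  rw [hx, real_inner_eq_re_inner, RCLike.inner_apply]
  simp [mul_comm]

theorem integrable_cc_mul (f : C_c(X, ℝ)) (u : Lp ℝ 2 μ) : Integrable (fun x => f x * u x) μ :=
  (f.continuous.memLp_of_hasCompactSupport f.hasCompactSupport (p := 2)).integrable_mul (Lp.memLp u)

theorem inner_ccToLp_ccToLp (f g : C_c(X, ℝ)) :
    inner ℝ (ccToLp μ f) (ccToLp μ g) = ∫ x, f x * g x ∂μ := by
  rw [inner_ccToLp_left]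
  refine integral_congr_ae ?_
  filter_upwards [coeFn_ccToLp (μ := μ) g] with x hx
  rw [hx]

omit [MeasurableSpace X] [BorelSpace X] in
theorem exists_abs_le_cc (f : C_c(X, ℝ)) : ∃ M > 0, ∀ x, |f x| ≤ M := by
  obtain ⟨C, hC⟩ := f.hasCompactSupport.exists_bound_of_continuous f.continuous
  exact ⟨max C 1, by positivity, fun x => (hC x).trans (le_max_left _ _)⟩

omit [MeasurableSpace X] [BorelSpace X] in
theorem exists_cc_one_of_isCompact [R1Space X] [LocallyCompactSpace X] {K : Set X}
    (hK : IsCompact K) :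
    ∃ χ : C_c(X, ℝ), (∀ x ∈ K, χ x = 1) ∧ ∀ x, 0 ≤ χ x ∧ χ x ≤ 1 := by
  obtain ⟨f, h1, -, h3, h4⟩ := exists_continuous_one_zero_of_isCompact hK isClosed_empty
    (Set.disjoint_empty K)
  exact ⟨⟨f, h3⟩, fun x hx => h1 hx, h4⟩

end

/-! ### The algebra structure of 𝓒 and positivity of the Gram matrix. -/

namespace DirichletForm

variable {X : Type*} [TopologicalSpace X] [MeasurableSpace X] [BorelSpace X] {μ : Measure X}
  [IsFiniteMeasureOnCompacts μ] {E : DirichletForm μ}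

namespace IsResolvent

variable {β : ℝ} {T : Lp ℝ 2 μ →ₗ[ℝ] E.domain}

theorem cc_nonneg (hT : E.IsResolvent β T) (hβ : 0 < β) {f : C_c(X, ℝ)} (hf : ∀ x, 0 ≤ f x) :
    ∀ᵐ x ∂μ, 0 ≤ (T (ccToLp μ f) : Lp ℝ 2 μ) x := by
  obtain ⟨M, hM, hfM⟩ := exists_abs_le_cc f
  refine (hT.nonneg_le hβ hM ?_ ?_).1
  · filter_upwards [coeFn_ccToLp (μ := μ) f] with x hx
    rw [hx]; exact hf x
  · filter_upwards [coeFn_ccToLp (μ := μ) f] with x hx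
    rw [hx]; exact (le_abs_self _).trans (hfM x)

/-- Split f into positive and negative parts; only the positive part matters for an upper bound.
This one-sided form lets polynomial inequalities pass through T although constants need not lie in
L². -/
theorem cc_le (hT : E.IsResolvent β T) (hβ : 0 < β) {f : C_c(X, ℝ)} {κ : ℝ} (hκ : 0 ≤ κ)
    (hf : ∀ x, f x ≤ κ) : ∀ᵐ x ∂μ, (T (ccToLp μ f) : Lp ℝ 2 μ) x ≤ κ := by
  have hsub : f = (f ⊔ 0) - ((f ⊔ 0) - f) := by abel
  have hneg := hT.cc_nonneg hβ (f := (f ⊔ 0) - f) fun x => by simp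
  have hpos : ∀ᵐ x ∂μ, (T (ccToLp μ (f ⊔ 0)) : Lp ℝ 2 μ) x ≤ κ := by
    rcases hκ.eq_or_lt with rfl | hκ
    · have : f ⊔ 0 = 0 := by ext x; simpa using hf x
      rw [this, map_zero, map_zero]
      filter_upwards [Lp.coeFn_zero ℝ 2 μ] with x hx
      exact hx.le
    · refine (hT.nonneg_le hβ hκ ?_ ?_).2
      · filter_upwards [coeFn_ccToLp (μ := μ) (f ⊔ 0)] with x hx
        rw [hx]; simp
      · filter_upwards [coeFn_ccToLp (μ := μ) (f ⊔ 0)] with x hx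
        rw [hx]; simpa using ⟨hf x, hκ.le⟩
  have hT2 : (T (ccToLp μ f) : Lp ℝ 2 μ) = (T (ccToLp μ (f ⊔ 0)) : Lp ℝ 2 μ) -
      (T (ccToLp μ ((f ⊔ 0) - f)) : Lp ℝ 2 μ) := by
    rw [← Submodule.coe_sub, ← map_sub, ← map_sub, ← hsub]
  rw [hT2]
  filter_upwards [hneg, hpos, Lp.coeFn_sub (T (ccToLp μ (f ⊔ 0)) : Lp ℝ 2 μ)
      (T (ccToLp μ ((f ⊔ 0) - f)) : Lp ℝ 2 μ)] with x h1 h2 h3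
  rw [h3, Pi.sub_apply]
  linarith

/-- The carré du champ of a sub-Markovian operator is positive semidefinite, pointwise. -/
theorem ae_carre_nonneg (hT : E.IsResolvent β T) (hβ : 0 < β) {ι : Type*} [Fintype ι]
    (a : ι → C_c(X, ℝ)) : ∀ᵐ x ∂μ, ∀ θ : ι → ℝ, 0 ≤ ∑ i, ∑ j, θ i * θ j *
      (a i x * a j x - a i x * (T (ccToLp μ (a j)) : Lp ℝ 2 μ) x
        - a j x * (T (ccToLp μ (a i)) : Lp ℝ 2 μ) x
        + (T (ccToLp μ (a i * a j)) : Lp ℝ 2 μ) x) := by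
  set U : ι → Lp ℝ 2 μ := fun i => T (ccToLp μ (a i)) with hU
  set V : ι × ι → Lp ℝ 2 μ := fun p => T (ccToLp μ (a p.1 * a p.2)) with hV
  -- With a = ∑ θᵢaᵢ and a free number q = θ.2, apply T to 2qa - a² ≤ q².
  have key : ∀ᵐ x ∂μ, ∀ θ : (ι → ℝ) × ℝ, 0 ≤ θ.2 ^ 2 - (2 * θ.2 * ∑ i, θ.1 i * U i x -
      ∑ p : ι × ι, θ.1 p.1 * θ.1 p.2 * V p x) := by
    refine ae_forall_nonneg_of_continuous (fun x => by fun_prop) fun θ => ?_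
    set f : C_c(X, ℝ) := (2 * θ.2) • ∑ i, θ.1 i • a i -
      ∑ p : ι × ι, (θ.1 p.1 * θ.1 p.2) • (a p.1 * a p.2) with hf
    have h1 := hT.cc_le hβ (f := f) (sq_nonneg θ.2) fun x => by
      have e1 : ∑ p : ι × ι, (θ.1 p.1 * θ.1 p.2) * (a p.1 x * a p.2 x) =
          (∑ i, θ.1 i * a i x) ^ 2 := by
        rw [sq, Finset.sum_mul_sum, ← Finset.sum_product', Finset.univ_product_univ]
        exact Finset.sum_congr rfl fun p _ => by ring
      have e2 : f x = 2 * θ.2 * ∑ i, θ.1 i * a i x - (∑ i, θ.1 i * a i x) ^ 2 := by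
        rw [← e1, hf]
        simp
      rw [e2]
      nlinarith [sq_nonneg (θ.2 - ∑ i, θ.1 i * a i x)]
    have h2 : (T (ccToLp μ f) : Lp ℝ 2 μ) = (2 * θ.2) • ∑ i, θ.1 i • U i -
        ∑ p : ι × ι, (θ.1 p.1 * θ.1 p.2) • V p := by
      rw [hf]
      simp [hU, hV]
    rw [h2] at h1
    filter_upwards [h1, Lp.coeFn_sub ((2 * θ.2) • ∑ i, θ.1 i • U i)
        (∑ p : ι × ι, (θ.1 p.1 * θ.1 p.2) • V p), Lp.coeFn_smul (2 * θ.2) (∑ i, θ.1 i • U i),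
        coeFn_sum_smul Finset.univ θ.1 U,
        coeFn_sum_smul Finset.univ (fun p : ι × ι => θ.1 p.1 * θ.1 p.2) V] with x e1 e2 e3 e4 e5
    rw [e2, Pi.sub_apply, e3, Pi.smul_apply, e4, e5, smul_eq_mul] at e1
    linarith
  filter_upwards [key] with x hx θ
  -- Choosing q = a(x) at the point x gives a² - 2aTa + T(a²) ≥ 0.
  have h1 := hx (θ, ∑ i, θ i * a i x)
  simp only at h1
  rw [Fintype.sum_prod_type] at h1
  have e1 : ∑ i, ∑ j, θ i * θ j * (a i x * a j x - a i x * U j x - a j x * U i x + V (i, j) x) =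
      (∑ i, θ i * a i x) * (∑ j, θ j * a j x) - (∑ i, θ i * a i x) * (∑ j, θ j * U j x)
      - (∑ i, θ i * U i x) * (∑ j, θ j * a j x) + ∑ i, ∑ j, θ i * θ j * V (i, j) x := by
    simp only [Finset.sum_mul_sum, ← Finset.sum_sub_distrib, ← Finset.sum_add_distrib]
    exact Finset.sum_congr rfl fun i _ => Finset.sum_congr rfl fun j _ => by ring
  have e2 : 0 ≤ ∑ i, ∑ j, θ i * θ j *
      (a i x * a j x - a i x * U j x - a j x * U i x + V (i, j) x) := by
    rw [e1]
    linarith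
  exact e2

/-- This is (s² - t²)² ≤ 4M²(s - t)² for |s|, |t| ≤ M, integrated against the symmetric kernel of T.
No kernel is needed: t is frozen as a number q, T acts in s, and then q = f(x). The cutoff χ stands
in for the constant 1. -/
theorem inner_sq_le [R1Space X] [LocallyCompactSpace X] (hT : E.IsResolvent β T) (hβ : 0 < β)
    {f : C_c(X, ℝ)} {M : ℝ} (hM : ∀ x, |f x| ≤ M) :
    inner ℝ (ccToLp μ (f * f) - (T (ccToLp μ (f * f)) : Lp ℝ 2 μ)) (ccToLp μ (f * f)) ≤
      4 * M ^ 2 * inner ℝ (ccToLp μ f - (T (ccToLp μ f) : Lp ℝ 2 μ)) (ccToLp μ f) := by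
  obtain ⟨χ, hχ, hχ01⟩ := exists_cc_one_of_isCompact f.hasCompactSupport.isCompact
  have hχf : ∀ x, χ x * f x = f x := fun x => by
    by_cases h : x ∈ tsupport f
    · rw [hχ x h, one_mul]
    · rw [image_eq_zero_of_notMem_tsupport h, mul_zero]
  set f2 := f * f with hf2
  set f4 := f2 * f2 with hf4
  set U : Lp ℝ 2 μ := ((T (ccToLp μ f) : E.domain) : Lp ℝ 2 μ) with hU
  set U2 : Lp ℝ 2 μ := ((T (ccToLp μ f2) : E.domain) : Lp ℝ 2 μ) with hU2
  set U4 : Lp ℝ 2 μ := ((T (ccToLp μ f4) : E.domain) : Lp ℝ 2 μ) with hU4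
  set g : C_c(X, ℝ) := (4 * M ^ 2) • f2 - f4 with hg
  have hgx : ∀ x, g x = 4 * M ^ 2 * (f x * f x) - f x * f x * (f x * f x) := fun x => by
    simp [hg, hf4, hf2]
  have hfM : ∀ x, f x * f x ≤ M ^ 2 := fun x => by
    have := hM x
    rw [← sq, ← sq_abs]; gcongr
  have hg0 : ∀ x, 0 ≤ g x := fun x => by
    rw [hgx]; nlinarith [hfM x, mul_self_nonneg (f x), sq_nonneg M]
  have key : ∀ᵐ x ∂μ, ∀ q : Set.Icc (-M) M, 0 ≤ (4 * M ^ 2 * (q : ℝ) ^ 2 - (q : ℝ) ^ 4) +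
      (4 * M ^ 2 * (U2 x - 2 * q * U x) - (U4 x - 2 * (q : ℝ) ^ 2 * U2 x)) := by
    refine ae_forall_nonneg_of_continuous (fun x => by fun_prop) fun q => ?_
    obtain ⟨q, hq⟩ := q
    have hq' : q ^ 2 ≤ M ^ 2 := sq_le_sq' hq.1 hq.2
    set G : C_c(X, ℝ) := (8 * M ^ 2 * q) • f - (4 * M ^ 2 + 2 * q ^ 2) • f2 + f4 with hG
    have h1 := hT.cc_le hβ (f := G) (κ := 4 * M ^ 2 * q ^ 2 - q ^ 4)
      (by nlinarith [sq_nonneg q, sq_nonneg M]) fun x => by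
        have e : G x = 8 * M ^ 2 * q * f x - (4 * M ^ 2 + 2 * q ^ 2) * (f x * f x) +
            f x * f x * (f x * f x) := by
          simp [hG, hf4, hf2]
        rw [e]
        have h3 : (q + f x) ^ 2 ≤ (2 * M) ^ 2 := by
          obtain ⟨h4, h5⟩ := abs_le.1 (hM x)
          exact sq_le_sq' (by linarith [hq.1]) (by linarith [hq.2])
        nlinarith [mul_nonneg (sq_nonneg (q - f x)) (sub_nonneg.2 h3)]
    have h2 : (T (ccToLp μ G) : Lp ℝ 2 μ) =
        (8 * M ^ 2 * q) • U - (4 * M ^ 2 + 2 * q ^ 2) • U2 + U4 := by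
      rw [hG]; simp [hU, hU2, hU4]
    rw [h2] at h1
    filter_upwards [h1, Lp.coeFn_add ((8 * M ^ 2 * q) • U - (4 * M ^ 2 + 2 * q ^ 2) • U2) U4,
      Lp.coeFn_sub ((8 * M ^ 2 * q) • U) ((4 * M ^ 2 + 2 * q ^ 2) • U2),
      Lp.coeFn_smul (8 * M ^ 2 * q) U, Lp.coeFn_smul (4 * M ^ 2 + 2 * q ^ 2) U2]
      with x e1 e2 e3 e4 e5
    rw [e2, Pi.add_apply, e3, Pi.sub_apply, e4, e5, Pi.smul_apply, Pi.smul_apply, smul_eq_mul,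
      smul_eq_mul] at e1
    linarith
  have hpt : ∀ᵐ x ∂μ, 0 ≤ (χ x * g x + 4 * M ^ 2 * (χ x * U2 x)) -
      8 * M ^ 2 * (f x * U x) - χ x * U4 x + 2 * (f2 x * U2 x) := by
    filter_upwards [key] with x hx
    have h1 := mul_nonneg (hχ01 x).1 (hx ⟨f x, abs_le.1 (hM x)⟩)
    simp only at h1
    have e1 : χ x * (f x * U x) = f x * U x := by rw [← mul_assoc, hχf]
    have e2 : χ x * (f2 x * U2 x) = f2 x * U2 x := by
      simp only [hf2, CompactlySupportedContinuousMap.mul_apply]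
      rw [← mul_assoc, ← mul_assoc, hχf]
    have e3 : f2 x = f x * f x := rfl
    rw [← e1, ← e2, hgx, e3]
    refine h1.trans_eq ?_
    ring
  have hint := integral_nonneg_of_ae hpt
  have i1 : Integrable (fun x => χ x * g x) μ := (χ * g).continuous.integrable_of_hasCompactSupport
    (χ * g).hasCompactSupport
  have i2 := (integrable_cc_mul (μ := μ) χ U2).const_mul (4 * M ^ 2)
  have i3 := (integrable_cc_mul (μ := μ) f U).const_mul (8 * M ^ 2)
  have i4 := integrable_cc_mul (μ := μ) χ U4
  have i5 := (integrable_cc_mul (μ := μ) f2 U2).const_mul 2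
  have i12 : Integrable (fun x => χ x * g x + 4 * M ^ 2 * (χ x * U2 x)) μ := i1.add i2
  rw [integral_sub_sub_add i12 i3 i4 i5, integral_add i1 i2, integral_const_mul, integral_const_mul,
    integral_const_mul, ← inner_ccToLp_ccToLp, ← inner_ccToLp_left, ← inner_ccToLp_left,
    ← inner_ccToLp_left, ← inner_ccToLp_left] at hint
  have hUg : (4 * M ^ 2) • U2 - U4 = T (ccToLp μ g) := by
    rw [hg]; simp [hU2, hU4]
  -- By symmetry ⟨χ, Tg⟩ = ⟨Tχ, g⟩, where Tχ ≤ 1, g ≥ 0, and χ = 1 wherever g ≠ 0.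
  have hle : inner ℝ (ccToLp μ χ) ((4 * M ^ 2) • U2 - U4) ≤ inner ℝ (ccToLp μ χ) (ccToLp μ g) := by
    rw [hUg, ← hT.inner_comm hβ, real_inner_comm, real_inner_comm (ccToLp μ g),
      inner_ccToLp_left, inner_ccToLp_ccToLp]
    refine integral_mono_ae (integrable_cc_mul _ _) ((g * χ).continuous.integrable_of_hasCompactSupport
      (g * χ).hasCompactSupport) ?_
    filter_upwards [hT.cc_le hβ zero_le_one fun x => (hχ01 x).2] with x hx
    by_cases h : f x = 0
    · have : g x = 0 := by rw [hgx, h]; ring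
      simp [this]
    · have : χ x = 1 := mul_right_cancel₀ h (by rw [hχf, one_mul])
      simp only [this]
      exact mul_le_mul_of_nonneg_left hx (hg0 x)
  have hχg : inner ℝ (ccToLp μ χ) (ccToLp μ g) = 4 * M ^ 2 * inner ℝ (ccToLp μ f) (ccToLp μ f) -
      inner ℝ (ccToLp μ f2) (ccToLp μ f2) := by
    rw [inner_ccToLp_ccToLp, inner_ccToLp_ccToLp, inner_ccToLp_ccToLp, ← integral_const_mul,
      ← integral_sub]
    · refine integral_congr_ae (ae_of_all _ fun x => ?_)
      simp only [hgx, hf2, CompactlySupportedContinuousMap.mul_apply]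
      linear_combination (4 * M ^ 2 * f x - f x * f x * f x) * hχf x
    · exact ((f * f).continuous.integrable_of_hasCompactSupport (f * f).hasCompactSupport).const_mul _
    · exact (f2 * f2).continuous.integrable_of_hasCompactSupport (f2 * f2).hasCompactSupport
  rw [inner_sub_right, inner_smul_right] at hle
  rw [inner_sub_left, inner_sub_left, real_inner_comm _ U2, real_inner_comm _ U]
  linarith

end IsResolvent

variable [R1Space X] [LocallyCompactSpace X]

theorem mul_self_mem_core {f : C_c(X, ℝ)} (hf : f ∈ E.core) : f * f ∈ E.core := by
  obtain ⟨M, -, hM⟩ := exists_abs_le_cc f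
  obtain ⟨T, hT⟩ := E.exists_resolvents
  have hpos : ∀ n : ℕ, (0 : ℝ) < n + 1 := fun n => by positivity
  obtain ⟨v, hv, -⟩ := exists_mem_domain_of_bounded hT (ccToLp μ (f * f))
    (4 * M ^ 2 * E.form ⟨ccToLp μ f, hf⟩ ⟨ccToLp μ f, hf⟩) fun n => by
      have h1 := (hT n).inner_sq_le (hpos n) hM
      have h2 := (hT n).inner_le_form (hpos n) ⟨ccToLp μ f, hf⟩
      have h3 := mul_le_mul_of_nonneg_left h1 (hpos n).le
      have h4 := mul_le_mul_of_nonneg_left h2 (by positivity : 0 ≤ 4 * M ^ 2)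
      simp only at h4
      linarith
  change ccToLp μ (f * f) ∈ E.domain
  exact hv ▸ v.2

theorem mul_mem_core {f g : C_c(X, ℝ)} (hf : f ∈ E.core) (hg : g ∈ E.core) : f * g ∈ E.core := by
  have h : f * g = (1 / 4 : ℝ) • ((f + g) * (f + g) - (f - g) * (f - g)) := by
    ext x
    simp
    ring
  rw [h]
  exact E.core.smul_mem _ (E.core.sub_mem (mul_self_mem_core (E.core.add_mem hf hg))
    (mul_self_mem_core (E.core.sub_mem hf hg)))

instance : Mul E.core := ⟨fun f g => ⟨f * g, mul_mem_core f.2 g.2⟩⟩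

@[simp]
theorem coe_mul_core (f g : E.core) : ((f * g : E.core) : C_c(X, ℝ)) = f * g := rfl

instance : NonUnitalCommRing E.core :=
  Subtype.val_injective.nonUnitalCommRing _ rfl (fun _ _ => rfl) (fun _ _ => rfl) (fun _ => rfl)
    (fun _ _ => rfl) (fun _ _ => rfl) fun _ _ => rfl

variable (E) in
/-- The form on the core. -/
def coreForm : E.core →ₗ[ℝ] E.core →ₗ[ℝ] ℝ :=
  E.form.compl₁₂ E.coreToDomain E.coreToDomain

omit [R1Space X] [LocallyCompactSpace X] in
theorem formCc_coe (f g : E.core) : E.formCc f g = E.coreForm f g := by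
  rw [formCc, dif_pos ⟨f.2, g.2⟩]
  rfl

theorem energyIntegral_coe (φ a c : E.core) : E.energyIntegral φ a c =
    (E.coreForm (φ * a) c + E.coreForm (φ * c) a - E.coreForm φ (a * c)) / 2 := by
  simp only [energyIntegral, ← coe_mul_core, formCc_coe]

/-- Each of the three energies is a limit of β⟨u - Tu, v⟩. In the combination the multiplication
terms collapse to a single φac, leaving the carré du champ of T weighted by φ. -/
theorem tendsto_energyIntegral {T : ℕ → Lp ℝ 2 μ →ₗ[ℝ] E.domain}
    (hT : ∀ n : ℕ, E.IsResolvent (n + 1) (T n)) (φ a c : E.core) :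
    Tendsto (fun n : ℕ => ((n : ℝ) + 1) / 2 * ∫ x, (φ : C_c(X, ℝ)) x *
      ((a : C_c(X, ℝ)) x * (c : C_c(X, ℝ)) x
        - (a : C_c(X, ℝ)) x * (T n (ccToLp μ c) : Lp ℝ 2 μ) x
        - (c : C_c(X, ℝ)) x * (T n (ccToLp μ a) : Lp ℝ 2 μ) x
        + (T n (ccToLp μ (a * c)) : Lp ℝ 2 μ) x) ∂μ) atTop (𝓝 (E.energyIntegral φ a c)) := by
  rw [energyIntegral_coe]
  have h := fun u v : E.core => tendsto_resolvent_inner hT (E.coreToDomain u) (E.coreToDomain v)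
  have h1 := h c (φ * a)
  have h2 := h a (φ * c)
  have h3 := h (a * c) φ
  have e : (E.coreForm (φ * a) c + E.coreForm (φ * c) a - E.coreForm φ (a * c)) / 2 =
      (E.form (E.coreToDomain c) (E.coreToDomain (φ * a)) +
        E.form (E.coreToDomain a) (E.coreToDomain (φ * c)) -
        E.form (E.coreToDomain (a * c)) (E.coreToDomain φ)) / 2 := by
    rw [E.symm (E.coreToDomain c), E.symm (E.coreToDomain a), E.symm (E.coreToDomain (a * c))]
    rfl
  rw [e]
  refine (((h1.add h2).sub h3).div_const 2).congr fun n => ?_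
  have e2 : ∀ u v : E.core, inner ℝ (((E.coreToDomain u : E.domain) : Lp ℝ 2 μ) -
      T n (E.coreToDomain u : E.domain)) ((E.coreToDomain v : E.domain) : Lp ℝ 2 μ) =
      (∫ x, (v : C_c(X, ℝ)) x * (u : C_c(X, ℝ)) x ∂μ) -
      ∫ x, (v : C_c(X, ℝ)) x * (T n (ccToLp μ u) : Lp ℝ 2 μ) x ∂μ := fun u v => by
    rw [← inner_ccToLp_left, ← inner_ccToLp_ccToLp, ← inner_sub_right, real_inner_comm]
    rfl
  have icc : ∀ u : C_c(X, ℝ), Integrable (fun x => u x) μ := fun u =>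
    u.continuous.integrable_of_hasCompactSupport u.hasCompactSupport
  rw [e2, e2, e2]
  have i1 := icc (φ * (a * c))
  have i2 := integrable_cc_mul (μ := μ) (φ * a : C_c(X, ℝ)) (T n (ccToLp μ c))
  have i3 := integrable_cc_mul (μ := μ) (φ * c : C_c(X, ℝ)) (T n (ccToLp μ a))
  have i4 := integrable_cc_mul (μ := μ) (φ : C_c(X, ℝ)) (T n (ccToLp μ (a * c)))
  have e3 : (∫ x, (φ : C_c(X, ℝ)) x *
      ((a : C_c(X, ℝ)) x * (c : C_c(X, ℝ)) x
        - (a : C_c(X, ℝ)) x * (T n (ccToLp μ c) : Lp ℝ 2 μ) x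
        - (c : C_c(X, ℝ)) x * (T n (ccToLp μ a) : Lp ℝ 2 μ) x
        + (T n (ccToLp μ (a * c)) : Lp ℝ 2 μ) x) ∂μ) =
      ∫ x, ((φ * (a * c) : C_c(X, ℝ)) x
        - (φ * a : C_c(X, ℝ)) x * (T n (ccToLp μ c) : Lp ℝ 2 μ) x
        - (φ * c : C_c(X, ℝ)) x * (T n (ccToLp μ a) : Lp ℝ 2 μ) x
        + (φ : C_c(X, ℝ)) x * (T n (ccToLp μ (a * c)) : Lp ℝ 2 μ) x) ∂μ :=
    integral_congr_ae (ae_of_all _ fun x => by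
      simp only [CompactlySupportedContinuousMap.mul_apply]; ring)
  rw [e3, integral_sub_sub_add i1 i2 i3 i4]
  have e4 : ∀ u v : E.core, (u : C_c(X, ℝ)) * v = φ * (a * c) →
      (∫ x, (u : C_c(X, ℝ)) x * (v : C_c(X, ℝ)) x ∂μ) = ∫ x, (φ * (a * c) : C_c(X, ℝ)) x ∂μ :=
    fun u v h => by
      rw [← h]; rfl
  rw [e4 (φ * a) c (by rw [coe_mul_core, mul_assoc]),
    e4 (φ * c) a (by rw [coe_mul_core, mul_assoc, mul_comm (a : C_c(X, ℝ))]),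
    e4 φ (a * c) (by rw [coe_mul_core])]
  simp only [coe_mul_core]
  ring

/-- Before the limit, the integrand at x is the nonnegative quadratic form of `ae_carre_nonneg`
evaluated at θᵢ = wᵢbᵢ(x). -/
theorem energyIntegral_psd {ι : Type*} [Fintype ι] (w : ι → ℝ) (a b : ι → E.core) :
    0 ≤ ∑ i, ∑ j, w i * w j * E.energyIntegral (b i * b j) (a i) (a j) := by
  obtain ⟨T, hT⟩ := E.exists_resolvents
  have h := tendsto_finsetSum Finset.univ fun i _ => tendsto_finsetSum Finset.univ fun j _ =>
    (tendsto_energyIntegral hT (b i * b j) (a i) (a j)).const_mul (w i * w j)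
  refine ge_of_tendsto' h fun n => ?_
  have i0 : ∀ i j, Integrable (fun x => (b i * b j : C_c(X, ℝ)) x *
      ((a i : C_c(X, ℝ)) x * (a j : C_c(X, ℝ)) x
        - (a i : C_c(X, ℝ)) x * (T n (ccToLp μ (a j)) : Lp ℝ 2 μ) x
        - (a j : C_c(X, ℝ)) x * (T n (ccToLp μ (a i)) : Lp ℝ 2 μ) x
        + (T n (ccToLp μ (a i * a j)) : Lp ℝ 2 μ) x)) μ := fun i j => by
    have i1 : Integrable (fun x => ((b i * b j : C_c(X, ℝ)) * (a i * a j)) x) μ :=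
      (map_continuous _).integrable_of_hasCompactSupport
        (CompactlySupportedContinuousMap.hasCompactSupport _)
    have i2 := integrable_cc_mul (μ := μ) (b i * b j * a i : C_c(X, ℝ)) (T n (ccToLp μ (a j)))
    have i3 := integrable_cc_mul (μ := μ) (b i * b j * a j : C_c(X, ℝ)) (T n (ccToLp μ (a i)))
    have i4 := integrable_cc_mul (μ := μ) (b i * b j : C_c(X, ℝ)) (T n (ccToLp μ (a i * a j)))
    refine (((i1.sub i2).sub i3).add i4).congr (ae_of_all _ fun x => ?_)
    simp only [CompactlySupportedContinuousMap.mul_apply, Pi.add_apply, Pi.sub_apply]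
    ring
  have e : ∑ i, ∑ j, w i * w j * (((n : ℝ) + 1) / 2 * ∫ x, (b i * b j : C_c(X, ℝ)) x *
      ((a i : C_c(X, ℝ)) x * (a j : C_c(X, ℝ)) x
        - (a i : C_c(X, ℝ)) x * (T n (ccToLp μ (a j)) : Lp ℝ 2 μ) x
        - (a j : C_c(X, ℝ)) x * (T n (ccToLp μ (a i)) : Lp ℝ 2 μ) x
        + (T n (ccToLp μ (a i * a j)) : Lp ℝ 2 μ) x) ∂μ) =
      ((n : ℝ) + 1) / 2 * ∫ x, ∑ i, ∑ j, w i * w j * ((b i * b j : C_c(X, ℝ)) x *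
      ((a i : C_c(X, ℝ)) x * (a j : C_c(X, ℝ)) x
        - (a i : C_c(X, ℝ)) x * (T n (ccToLp μ (a j)) : Lp ℝ 2 μ) x
        - (a j : C_c(X, ℝ)) x * (T n (ccToLp μ (a i)) : Lp ℝ 2 μ) x
        + (T n (ccToLp μ (a i * a j)) : Lp ℝ 2 μ) x)) ∂μ := by
    rw [integral_finsetSum _ fun i _ => integrable_finsetSum _ fun j _ => (i0 i j).const_mul _,
      Finset.mul_sum]
    refine Finset.sum_congr rfl fun i _ => ?_
    rw [integral_finsetSum _ fun j _ => (i0 i j).const_mul _, Finset.mul_sum]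
    refine Finset.sum_congr rfl fun j _ => ?_
    rw [integral_const_mul]
    ring
  refine le_of_le_of_eq (mul_nonneg (by positivity) (integral_nonneg_of_ae ?_)) e.symm
  filter_upwards [(hT n).ae_carre_nonneg (by positivity) fun i => (a i : C_c(X, ℝ))] with x hx
  refine (hx fun i => w i * (b i : C_c(X, ℝ)) x).trans_eq ?_
  refine Finset.sum_congr rfl fun i _ => Finset.sum_congr rfl fun j _ => ?_
  simp only [CompactlySupportedContinuousMap.mul_apply]
  ring

variable (E) in
theorem gram_posSemidef : E.gram.PosSemidef := by
  have hsymm : ∀ p q : E.core × E.core, E.energyIntegral (p.2 * q.2 : C_c(X, ℝ)) p.1 q.1 =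
      E.energyIntegral (q.2 * p.2 : C_c(X, ℝ)) q.1 p.1 := fun p q => by
    simp only [← coe_mul_core, energyIntegral_coe]
    rw [mul_comm p.2, mul_comm p.1 q.1]
    ring
  refine ⟨?_, fun z => ?_⟩
  · ext p q
    simp only [Matrix.conjTranspose_apply, gram, Matrix.of_apply]
    rw [hsymm]
    simp
  · classical
    -- For a real symmetric matrix the complex form is the sum of the real forms at Re z and Im z,
    -- since the cross terms cancel.
    have e : (z.sum fun p zp => z.sum fun q zq => star zp * E.gram p q * zq) =
        ((∑ p : z.support, ∑ q : z.support, (z p).re * (z q).re *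
            E.energyIntegral ((p : E.core × E.core).2 * (q : E.core × E.core).2)
              (p : E.core × E.core).1 (q : E.core × E.core).1 +
          ∑ p : z.support, ∑ q : z.support, (z p).im * (z q).im *
            E.energyIntegral ((p : E.core × E.core).2 * (q : E.core × E.core).2)
              (p : E.core × E.core).1 (q : E.core × E.core).1 : ℝ) : ℂ) := by
      simp only [Finsupp.sum]
      rw [← Finset.sum_coe_sort]
      simp only [← Finset.sum_coe_sort z.support]
      set N : z.support → z.support → ℝ := fun p q =>
        E.energyIntegral ((p : E.core × E.core).2 * (q : E.core × E.core).2)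
              (p : E.core × E.core).1 (q : E.core × E.core).1 with hN
      have hNs : ∀ p q, N p q = N q p := fun p q => hsymm p q
      have h1 : ∑ p : z.support, ∑ q : z.support, star (z p) * E.gram p q * z q =
          ∑ p : z.support, ∑ q : z.support, star (z p) * (N p q : ℂ) * z q := rfl
      rw [h1]
      apply Complex.ext
      · simp only [Complex.re_sum, Complex.ofReal_re, ← Finset.sum_add_distrib]
        refine Finset.sum_congr rfl fun p _ => Finset.sum_congr rfl fun q _ => ?_
        simp
        ring
      · have h2 : ∑ p : z.support, ∑ q : z.support, (z p).re * (z q).im * N p q =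
            ∑ p : z.support, ∑ q : z.support, (z p).im * (z q).re * N p q := by
          rw [Finset.sum_comm]
          refine Finset.sum_congr rfl fun p _ => Finset.sum_congr rfl fun q _ => ?_
          rw [hNs]; ring
        simp only [Complex.im_sum, Complex.ofReal_im]
        rw [← sub_eq_zero.2 h2, ← Finset.sum_sub_distrib]
        refine Finset.sum_congr rfl fun p _ => ?_
        rw [← Finset.sum_sub_distrib]
        refine Finset.sum_congr rfl fun q _ => ?_
        simp
        ring
    rw [e]
    refine Complex.zero_le_real.2 (add_nonneg ?_ ?_)
    · exact energyIntegral_psd (fun p : z.support => (z p).re) (fun p => (p : E.core × E.core).1)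
        fun p => (p : E.core × E.core).2
    · exact energyIntegral_psd (fun p : z.support => (z p).im) (fun p => (p : E.core × E.core).1)
        fun p => (p : E.core × E.core).2

end DirichletForm

/-! ### Cutoff functions, the absence of killing, and the real gradient. -/

namespace DirichletForm

variable {X : Type*} [TopologicalSpace X] [MeasurableSpace X] [BorelSpace X] {μ : Measure X}
  [IsFiniteMeasureOnCompacts μ] {E : DirichletForm μ}

theorem min_max_mem_core {g : C_c(X, ℝ)} (hg : g ∈ E.core) {f : C_c(X, ℝ)}
    (hf : ∀ x, f x = min (max 0 (g x)) 1) : f ∈ E.core := by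
  obtain ⟨h, -⟩ := E.markov ⟨ccToLp μ g, hg⟩ (ccToLp μ f) (by
    filter_upwards [coeFn_ccToLp (μ := μ) f, coeFn_ccToLp (μ := μ) g] with x h1 h2
    rw [h1, hf, h2])
  exact h

/-- A family of cutoff functions in the core that increases to one along `l`. -/
structure IsCutoff {ι : Type*} (ψ : ι → E.core) (l : Filter ι) : Prop where
  nonneg : ∀ i x, 0 ≤ (ψ i : C_c(X, ℝ)) x
  le_one : ∀ i x, (ψ i : C_c(X, ℝ)) x ≤ 1
  eventually_eq_one : ∀ K : Set X, IsCompact K → ∀ᶠ i in l, ∀ x ∈ K, (ψ i : C_c(X, ℝ)) x = 1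

section

variable [R1Space X] [LocallyCompactSpace X]

theorem IsRegular.exists_core_one (h : E.IsRegular) {K : Set X} (hK : IsCompact K) :
    ∃ χ : E.core, (∀ x ∈ K, (χ : C_c(X, ℝ)) x = 1) ∧
      (∀ x, 0 ≤ (χ : C_c(X, ℝ)) x) ∧ ∀ x, (χ : C_c(X, ℝ)) x ≤ 1 := by
  obtain ⟨f, hf, -⟩ := exists_cc_one_of_isCompact hK
  -- Twice f within distance 1: then g ≥ 1 on K, and clipping to [0, 1] makes it exactly 1 there.
  obtain ⟨g, hg, hfg⟩ := h.1 ((2 : ℝ) • f) 1 one_pos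
  let c : C(ℝ, ℝ) := ⟨fun t => min (max 0 t) 1, by fun_prop⟩
  have hc : c 0 = 0 := by simp [c]
  have hx : ∀ x, g.compLeft c x = min (max 0 (g x)) 1 :=
    CompactlySupportedContinuousMap.compLeft_apply hc g
  refine ⟨⟨g.compLeft c, min_max_mem_core hg hx⟩, fun x hxK => ?_, fun x => ?_, fun x => ?_⟩
  · rw [hx]
    have h1 := abs_lt.1 (hfg x)
    rw [CompactlySupportedContinuousMap.smul_apply, hf x hxK] at h1
    rw [min_eq_right]
    refine le_max_of_le_right ?_
    simp only [smul_eq_mul] at h1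
    linarith
  · rw [hx]; positivity
  · rw [hx]; exact min_le_right _ _

theorem IsRegular.exists_isCutoff [SigmaCompactSpace X] (h : E.IsRegular) :
    ∃ χ : ℕ → E.core, IsCutoff χ atTop := by
  choose χ h1 h2 h3 using fun n => h.exists_core_one ((CompactExhaustion.choice X).isCompact n)
  refine ⟨χ, h2, h3, fun K hK => ?_⟩
  obtain ⟨n, hn⟩ := (CompactExhaustion.choice X).exists_superset_of_isCompact hK
  filter_upwards [eventually_ge_atTop n] with m hm x hx
  exact h1 m x ((CompactExhaustion.choice X).subset hm (hn hx))

namespace IsCutoff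

variable {ι : Type*} {l : Filter ι} {ψ : ι → E.core}

omit [R1Space X] [LocallyCompactSpace X] in
theorem comp (h : IsCutoff ψ l) {κ : Type*} {l' : Filter κ} {f : κ → ι} (hf : Tendsto f l' l) :
    IsCutoff (fun k => ψ (f k)) l' :=
  ⟨fun _ => h.nonneg _, fun _ => h.le_one _, fun K hK => hf.eventually (h.eventually_eq_one K hK)⟩

theorem mul {ψ' : ι → E.core} (h : IsCutoff ψ l) (h' : IsCutoff ψ' l) :
    IsCutoff (fun i => ψ i * ψ' i) l :=
  ⟨fun i x => mul_nonneg (h.nonneg i x) (h'.nonneg i x),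
    fun i x => mul_le_one₀ (h.le_one i x) (h'.nonneg i x) (h'.le_one i x), fun K hK => by
      filter_upwards [h.eventually_eq_one K hK, h'.eventually_eq_one K hK] with i h1 h2 x hx
      simp [h1 x hx, h2 x hx]⟩

theorem eventually_mul_eq (h : IsCutoff ψ l) (a : E.core) : ∀ᶠ i in l, ψ i * a = a := by
  filter_upwards [h.eventually_eq_one _ (a : C_c(X, ℝ)).hasCompactSupport.isCompact] with i hi
  ext x
  by_cases hx : x ∈ tsupport (a : C_c(X, ℝ))
  · simp [hi x hx]
  · simp [image_eq_zero_of_notMem_tsupport hx]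

/-- The absence of killing enters here; a killing measure k would leave ∫ b dk. The local part
vanishes once ψ = 1 near the support of b, and the jump part vanishes in the limit by dominated
convergence. -/
theorem tendsto_coreForm [l.IsCountablyGenerated] (h : IsCutoff ψ l) (hreg : E.IsRegular)
    (hkill : E.HasNoKilling) (b : E.core) :
    Tendsto (fun i => E.coreForm (ψ i) b) l (𝓝 0) := by
  obtain ⟨Ec, J, hBD⟩ := hkill
  have hS := (b : C_c(X, ℝ)).hasCompactSupport.isCompact
  obtain ⟨χ, hχ, hχ0, hχ1⟩ := hreg.exists_core_one hS
  obtain ⟨K, hK, hSK⟩ := exists_compact_superset hS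
  set F : ι → X × X → ℝ := fun i p => ((ψ i : C_c(X, ℝ)) p.1 - (ψ i : C_c(X, ℝ)) p.2) *
    ((b : C_c(X, ℝ)) p.1 - (b : C_c(X, ℝ)) p.2) with hF
  have hlim : Tendsto (fun i => ∫ p, F i p ∂J) l (𝓝 (∫ _, 0 ∂J)) := by
    refine tendsto_integral_filter_of_dominated_convergence
      (fun p => ‖((χ : C_c(X, ℝ)) p.1 - (χ : C_c(X, ℝ)) p.2) *
        ((b : C_c(X, ℝ)) p.1 - (b : C_c(X, ℝ)) p.2)‖) (Eventually.of_forall fun i =>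
        (hBD.jump_integrable (ψ i) b).aestronglyMeasurable) ?_ (hBD.jump_integrable χ b).norm
      (ae_of_all _ fun p => ?_)
    · filter_upwards [h.eventually_eq_one _ hS,
        h.eventually_eq_one _ (χ : C_c(X, ℝ)).hasCompactSupport.isCompact] with i hi hi'
      refine ae_of_all _ fun p => ?_
      have hle : ∀ x, (χ : C_c(X, ℝ)) x ≤ (ψ i : C_c(X, ℝ)) x := fun x => by
        by_cases hx : x ∈ tsupport (χ : C_c(X, ℝ))
        · rw [hi' x hx]; exact hχ1 x
        · rw [image_eq_zero_of_notMem_tsupport hx]; exact h.nonneg i x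
      -- Both χ and ψ equal 1 at x, so the claim is 1 - ψ(y) ≤ 1 - χ(y). A fixed cutoff χ thus
      -- provides the integrable majorant.
      have hdiff : ∀ x y, x ∈ tsupport (b : C_c(X, ℝ)) →
          |(ψ i : C_c(X, ℝ)) x - (ψ i : C_c(X, ℝ)) y| ≤
            |(χ : C_c(X, ℝ)) x - (χ : C_c(X, ℝ)) y| := fun x y hx => by
        rw [hi x hx, hχ x hx, abs_of_nonneg (sub_nonneg.2 (h.le_one i y)),
          abs_of_nonneg (sub_nonneg.2 (hχ1 y))]
        linarith [hle y]
      simp only [hF, norm_mul, Real.norm_eq_abs]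
      by_cases h1 : p.1 ∈ tsupport (b : C_c(X, ℝ))
      · exact mul_le_mul_of_nonneg_right (hdiff _ _ h1) (abs_nonneg _)
      by_cases h2 : p.2 ∈ tsupport (b : C_c(X, ℝ))
      · rw [abs_sub_comm, abs_sub_comm ((χ : C_c(X, ℝ)) p.1)]
        exact mul_le_mul_of_nonneg_right (hdiff _ _ h2) (abs_nonneg _)
      · rw [image_eq_zero_of_notMem_tsupport h1, image_eq_zero_of_notMem_tsupport h2]
        simp
    · refine tendsto_const_nhds.congr' ?_
      filter_upwards [h.eventually_eq_one {p.1, p.2} (Set.toFinite _).isCompact] with i hi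
      simp [hF, hi p.1 (by simp), hi p.2 (by simp)]
  rw [integral_zero] at hlim
  refine hlim.congr' ?_
  filter_upwards [h.eventually_eq_one K hK] with i hi
  change _ = E.form (E.coreToDomain (ψ i)) (E.coreToDomain b)
  rw [hBD.decomposition, hBD.strongly_local (ψ i) b (interior K) 1 isOpen_interior hSK
    fun x hx => hi x (interior_subset hx)]
  simp [hF]

/-- Eventually ψa = a and ψc = c, so only the term 𝓔(ψ, ac)/2 differs from 𝓔(a, c), and it tends to
zero. -/
theorem tendsto_energyIntegral [l.IsCountablyGenerated] (h : IsCutoff ψ l) (hreg : E.IsRegular)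
    (hkill : E.HasNoKilling) (a c : E.core) :
    Tendsto (fun i => E.energyIntegral (ψ i) a c) l (𝓝 (E.coreForm a c)) := by
  have h1 := (tendsto_const_nhds (x := E.coreForm a c)).sub
    ((h.tendsto_coreForm hreg hkill (a * c)).div_const 2)
  simp only [zero_div, sub_zero] at h1
  refine h1.congr' ?_
  filter_upwards [h.eventually_mul_eq a, h.eventually_mul_eq c] with i h2 h3
  rw [energyIntegral_coe, h2, h3]
  have : E.coreForm c a = E.coreForm a c := E.symm _ _
  rw [this]; ring

end IsCutoff

theorem inner_tensor (a b c d : E.core) :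
    inner ℂ (E.tensor a b) (E.tensor c d) = (E.energyIntegral (b * d) a c : ℂ) := by
  refine (UniformSpace.Completion.inner_coe (𝕜 := ℂ) (E := E.PreOneForm) _ _).trans ?_
  change (Finsupp.sum (Finsupp.single (a, b) (1 : ℂ)) fun p z =>
    Finsupp.sum (Finsupp.single (c, d) (1 : ℂ)) fun q w => star z * E.gramPos p q * w) = _
  rw [Finsupp.sum_single_index (by simp), Finsupp.sum_single_index (by simp), gramPos,
    if_pos E.gram_posSemidef]
  simp [gram]

-- Simple tensors span a dense subspace of 𝓗.
omit [R1Space X] [LocallyCompactSpace X] in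
theorem OneForm.ext_inner {η η' : E.OneForm}
    (h : ∀ c d, inner ℂ (E.tensor c d) η = inner ℂ (E.tensor c d) η') : η = η' := by
  refine ext_inner_left ℂ fun x => ?_
  induction x using UniformSpace.Completion.induction_on with
  | hp => exact isClosed_eq (by fun_prop) (by fun_prop)
  | ih x =>
    refine Finsupp.induction_linear
      (motive := fun x : (E.core × E.core) →₀ ℂ =>
        inner ℂ (UniformSpace.Completion.coe' (α := E.PreOneForm) x) η =
          inner ℂ (UniformSpace.Completion.coe' (α := E.PreOneForm) x) η') x ?_ ?_ ?_
    · have : (UniformSpace.Completion.coe' (α := E.PreOneForm) (0 : (E.core × E.core) →₀ ℂ)) = 0 :=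
        UniformSpace.Completion.coe_zero
      rw [this, inner_zero_left, inner_zero_left]
    · intro y z hy hz
      have : (UniformSpace.Completion.coe' (α := E.PreOneForm) (y + z)) =
          UniformSpace.Completion.coe' (α := E.PreOneForm) y +
          UniformSpace.Completion.coe' (α := E.PreOneForm) z :=
        UniformSpace.Completion.coe_add (α := E.PreOneForm) y z
      rw [this, inner_add_left, inner_add_left, hy, hz]
    · rintro ⟨c, d⟩ z
      have : (UniformSpace.Completion.coe' (α := E.PreOneForm)
          (Finsupp.single (c, d) z : (E.core × E.core) →₀ ℂ)) = z • E.tensor c d := by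
        refine Eq.trans ?_ (UniformSpace.Completion.coe_smul (X := E.PreOneForm) z _)
        refine congrArg (UniformSpace.Completion.coe' (α := E.PreOneForm)) ?_
        change _ = z • (Finsupp.single (c, d) 1 : (E.core × E.core) →₀ ℂ)
        rw [Finsupp.smul_single, smul_eq_mul, mul_one]
      rw [this, inner_smul_left, inner_smul_left, h]

omit [R1Space X] [LocallyCompactSpace X] in
theorem IsGradient.unique {a : E.core} {η η' : E.OneForm} (h : E.IsGradient a η)
    (h' : E.IsGradient a η') : η = η' :=
  OneForm.ext_inner fun c d => (h c d).trans (h' c d).symm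

theorem mul_smul_core (d a : E.core) (r : ℝ) : d * (r • a) = r • (d * a) := by
  ext x
  simp
  ring

theorem energyIntegral_add_right (d c a a' : E.core) : E.energyIntegral d c ((a + a' : E.core)) =
    E.energyIntegral d c a + E.energyIntegral d c a' := by
  simp only [energyIntegral_coe, mul_add, map_add, LinearMap.add_apply]
  ring

theorem energyIntegral_smul_right (d c a : E.core) (r : ℝ) :
    E.energyIntegral d c ((r • a : E.core)) = r * E.energyIntegral d c a := by
  simp only [energyIntegral_coe, mul_smul_core, map_smul, LinearMap.smul_apply, smul_eq_mul]
  ring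

theorem IsGradient.add {a a' : E.core} {η η' : E.OneForm} (h : E.IsGradient a η)
    (h' : E.IsGradient a' η') : E.IsGradient (a + a') (η + η') := fun c d => by
  rw [inner_add_right, h, h', energyIntegral_add_right]
  push_cast
  rfl

theorem IsGradient.smul {a : E.core} {η : E.OneForm} (h : E.IsGradient a η) (r : ℝ) :
    E.IsGradient (r • a) (r • η) := fun c d => by
  rw [← Complex.coe_smul, inner_smul_right, h, energyIntegral_smul_right]
  push_cast
  rfl

section Gradient

variable [SigmaCompactSpace X] (hreg : E.IsRegular) (hkill : E.HasNoKilling)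
include hreg hkill

/-- The element a ⊗ 1 is the limit of a ⊗ χₙ, and ⟨a ⊗ χₙ, η'⟩ = ∫ χₙ dΓ(a, c) tends to 𝓔(a, c). -/
theorem exists_isGradient (a : E.core) : ∃ η, E.IsGradient a η ∧
    ∀ c η', E.IsGradient c η' → inner ℂ η η' = (E.coreForm a c : ℂ) := by
  obtain ⟨χ, hχ⟩ := hreg.exists_isCutoff
  have hc : CauchySeq fun n => E.tensor a (χ n) := by
    rw [cauchySeq_iff_tendsto_dist_atTop_0]
    -- Cutoffs indexed by pairs: ‖a ⊗ χₘ - a ⊗ χₙ‖² = ∫ (χₘ² - 2χₘχₙ + χₙ²) dΓ(a), and each of the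
    -- three products is again a cutoff family.
    have h1 : IsCutoff (fun p : ℕ × ℕ => χ p.1) atTop := hχ.comp
      (by rw [← prod_atTop_atTop_eq]; exact tendsto_fst)
    have h2 : IsCutoff (fun p : ℕ × ℕ => χ p.2) atTop := hχ.comp
      (by rw [← prod_atTop_atTop_eq]; exact tendsto_snd)
    have h3 := ((((h1.mul h1).tendsto_energyIntegral hreg hkill a a).sub
      (((h1.mul h2).tendsto_energyIntegral hreg hkill a a).const_mul 2)).add
      ((h2.mul h2).tendsto_energyIntegral hreg hkill a a)).sqrt
    have e : E.coreForm a a - 2 * E.coreForm a a + E.coreForm a a = 0 := by ring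
    rw [e, Real.sqrt_zero] at h3
    refine h3.congr fun p => ?_
    rw [dist_eq_norm]
    refine (Real.sqrt_eq_iff_eq_sq ?_ (norm_nonneg _)).2 ?_ |>.trans rfl
    all_goals
      have h4 := @norm_sub_sq ℂ _ _ _ _ (E.tensor a (χ p.1)) (E.tensor a (χ p.2))
      rw [← @inner_self_eq_norm_sq ℂ _ _ _ _ (E.tensor a (χ p.1)),
        ← @inner_self_eq_norm_sq ℂ _ _ _ _ (E.tensor a (χ p.2)), inner_tensor, inner_tensor,
        inner_tensor] at h4
      simp only [RCLike.re_to_complex, Complex.ofReal_re] at h4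
      simp only [coe_mul_core]
    · rw [← h4]; positivity
    · rw [h4]
  obtain ⟨η, hη⟩ := cauchySeq_tendsto_of_complete hc
  refine ⟨η, fun c d => ?_, fun c η' h' => ?_⟩
  · refine tendsto_nhds_unique ((tendsto_const_nhds (x := E.tensor c d)).inner hη) ?_
    refine tendsto_const_nhds.congr' ?_
    filter_upwards [hχ.eventually_mul_eq d] with n hn
    rw [inner_tensor, ← coe_mul_core, mul_comm d, hn]
  · refine tendsto_nhds_unique (hη.inner (tendsto_const_nhds (x := η'))) ?_
    have h1 := hχ.tendsto_energyIntegral hreg hkill a c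
    refine ((Complex.continuous_ofReal.tendsto _).comp h1).congr fun n => ?_
    rw [h' a (χ n)]
    rfl

/-- There is a bounded extension of the gradient to the form domain. -/
theorem exists_derivative : ∃ D : E.FormSpace →L[ℝ] E.OneForm,
    (∀ a : E.core, E.IsGradient a (D (FormSpace.ofDomain E (E.coreToDomain a)))) ∧
    ∀ u v : E.domain, inner ℂ (D (FormSpace.ofDomain E u)) (D (FormSpace.ofDomain E v)) =
      (E.form u v : ℂ) := by
  choose η hη hin using exists_isGradient hreg hkill
  let D₀ : E.core →ₗ[ℝ] E.OneForm :=
    { toFun := η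
      map_add' := fun a b => (hη _).unique ((hη a).add (hη b))
      map_smul' := fun r a => (hη _).unique ((hη a).smul r) }
  let e : E.core →ₗ[ℝ] E.FormSpace := (FormSpace.ofDomain E).toLinearMap ∘ₗ E.coreToDomain
  have he : DenseRange e := fun u => by
    refine Metric.mem_closure_range_iff.2 fun ε hε => ?_
    obtain ⟨g, hg⟩ := hreg.2 ((FormSpace.ofDomain E).symm u) (ε ^ 2) (by positivity)
    refine ⟨g, ?_⟩
    have h2 := FormSpace.norm_sq E ((FormSpace.ofDomain E).symm u - E.coreToDomain g)
    rw [map_sub, LinearEquiv.apply_symm_apply] at h2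
    rw [dist_eq_norm]
    exact lt_of_pow_lt_pow_left₀ 2 hε.le (h2.trans_lt hg)
  have hnorm : ∀ a, ‖D₀ a‖ ≤ 1 * ‖e a‖ := fun a => by
    rw [one_mul]
    refine (sq_le_sq₀ (norm_nonneg _) (norm_nonneg _)).1 ?_
    have h1 : ‖e a‖ ^ 2 = _ := FormSpace.norm_sq E (E.coreToDomain a)
    have h2 : ‖D₀ a‖ ^ 2 = E.coreForm a a := by
      rw [← @inner_self_eq_norm_sq ℂ, show D₀ a = η a from rfl, hin a a _ (hη a)]
      simp
    rw [h1, h2]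
    exact le_add_of_nonneg_right (sq_nonneg _)
  have hD : ∀ a, D₀.extendOfNorm e (e a) = η a := LinearMap.extendOfNorm_eq he ⟨1, hnorm⟩
  refine ⟨D₀.extendOfNorm e, fun a => ?_, fun u v => ?_⟩
  · have := hD a
    simp only [e, LinearMap.comp_apply, LinearEquiv.coe_coe] at this
    rw [this]; exact hη a
  · have key : ∀ u v : E.FormSpace, inner ℂ (D₀.extendOfNorm e u) (D₀.extendOfNorm e v) =
        ((inner ℝ u v - inner ℝ (FormSpace.toLp E u) (FormSpace.toLp E v) : ℝ) : ℂ) := by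
      intro u v
      refine DenseRange.induction_on₂ (p := fun u v => inner ℂ (D₀.extendOfNorm e u)
        (D₀.extendOfNorm e v) =
        ((inner ℝ u v - inner ℝ (FormSpace.toLp E u) (FormSpace.toLp E v) : ℝ) : ℂ)) he ?_ ?_ u v
      · exact isClosed_eq (by fun_prop) (by fun_prop)
      · intro a b
        rw [hD, hD, hin a b _ (hη b)]
        congr 1
        have h1 : inner ℝ (e a) (e b) = _ :=
          FormSpace.inner_def E (E.coreToDomain a) (E.coreToDomain b)
        rw [h1]
        exact (add_sub_cancel_right _ _).symm
    rw [key, FormSpace.inner_def]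
    congr 1
    exact add_sub_cancel_right _ _

end Gradient

end

end DirichletForm

/-! ### Orthonormal expansions and closed operators with a spectral family. -/

section Hilbert

variable {H K : Type*} [NormedAddCommGroup H] [InnerProductSpace ℂ H]
  [NormedAddCommGroup K] [InnerProductSpace ℂ K] {ι : Type*}

/-- A square summable family of coefficients yields a convergent orthonormal series. -/
theorem Orthonormal.summable_smul [CompleteSpace H] {e : ι → H} (he : Orthonormal ℂ e) {c : ι → ℂ}
    (hc : Summable fun j => ‖c j‖ ^ 2) : Summable fun j => c j • e j := by
  have h := he.orthogonalFamily.summable_iff_norm_sq_summable (f := c)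
  simpa using h.2 hc

theorem Orthonormal.exists_hasSum_inner [CompleteSpace H] {e : ι → H} (he : Orthonormal ℂ e) (x : H) :
    ∃ y, HasSum (fun j => inner ℂ (e j) x • e j) y ∧ ∀ j, inner ℂ (e j) (x - y) = 0 := by
  classical
  have hs := he.summable_smul (he.inner_products_summable x)
  refine ⟨_, hs.hasSum, fun i => ?_⟩
  have h := (innerSL ℂ (e i)).hasSum hs.hasSum
  have h2 : HasSum (fun j => innerSL ℂ (e i) (inner ℂ (e j) x • e j)) (inner ℂ (e i) x) := by
    convert hasSum_ite_eq i (inner ℂ (e i) x) using 2 with j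
    rw [innerSL_apply_apply, inner_smul_right, orthonormal_iff_ite.1 he]
    by_cases hij : j = i
    · subst hij; simp
    · rw [if_neg (Ne.symm hij), if_neg hij, mul_zero]
  have h3 := h.unique h2
  rw [innerSL_apply_apply] at h3
  rw [inner_sub_right, h3, sub_self]

/-- The remainder of the Bessel expansion is orthogonal to every e_j, hence to x and to the sum of
the series, hence to itself. -/
theorem Orthonormal.hasSum_inner_of_forall [CompleteSpace H] {e : ι → H} (he : Orthonormal ℂ e) {x : H}
    (hx : ∀ g, (∀ j, inner ℂ (e j) g = 0) → inner ℂ g x = 0) :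
    HasSum (fun j => inner ℂ (e j) x • e j) x := by
  obtain ⟨y, hy, hxy⟩ := he.exists_hasSum_inner x
  have h1 := hx _ hxy
  have h2 : inner ℂ (x - y) y = 0 := by
    have h := (innerSL ℂ (x - y)).hasSum hy
    refine h.unique ?_
    convert hasSum_zero using 2 with j
    rw [innerSL_apply_apply, inner_smul_right, inner_eq_zero_symm.1 (hxy j), mul_zero]
  have h3 : inner ℂ (x - y) (x - y) = 0 := by rw [inner_sub_right, h1, h2, sub_zero]
  rw [inner_self_eq_zero, sub_eq_zero] at h3
  exact h3 ▸ hy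

/-- If `φ` and `e` are orthonormal, then so are the vectors `(φ j, ± e j) / √2`. -/
theorem Orthonormal.sumElim_toLp {φ : ι → H} {e : ι → K} (hφ : Orthonormal ℂ φ)
    (he : Orthonormal ℂ e) :
    Orthonormal ℂ (Sum.elim (fun j => (1 / √2 : ℂ) • WithLp.toLp 2 (φ j, e j))
      fun j => (1 / √2 : ℂ) • WithLp.toLp 2 (φ j, -e j)) := by
  classical
  have h2 : ∀ z : ℂ, 1 / (√2 : ℂ) * ((starRingEnd ℂ) (1 / (√2 : ℂ)) * z) = z / 2 := fun z => by
    have : (√2 : ℂ) * √2 = 2 := by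
      rw [← Complex.ofReal_mul, Real.mul_self_sqrt zero_le_two]; norm_num
    rw [map_div₀, Complex.conj_ofReal, map_one, ← mul_assoc, div_mul_div_comm, this]
    ring
  rw [orthonormal_iff_ite] at hφ he ⊢
  rintro (i | i) (j | j) <;>
    simp only [Sum.elim_inl, Sum.elim_inr, inner_smul_left, inner_smul_right,
      WithLp.prod_inner_apply, inner_neg_left, inner_neg_right, h2, hφ, he, Sum.inl.injEq,
      Sum.inr.injEq, reduceCtorEq, if_false] <;>
    split_ifs <;> norm_num

namespace LinearPMap

/-- The vectors `φ j` are eigenvectors of `A† A` with positive eigenvalues `lam j`, and `A`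
vanishes on their orthogonal complement. -/
structure IsSpectralFamily (A : H →ₗ.[ℂ] K) (lam : ι → ℝ) (φ : ι → H) : Prop where
  dense : Dense (A.domain : Set H)
  closed : _root_.IsClosed (A.graph : Set (H × K))
  pos : ∀ j, 0 < lam j
  orthonormal : Orthonormal ℂ φ
  mem_domain : ∀ j, φ j ∈ A.domain
  inner_apply : ∀ j (u : A.domain),
    inner ℂ (A ⟨φ j, mem_domain j⟩) (A u) = lam j * inner ℂ (φ j) (u : H)
  apply_eq_zero : ∀ g : H, (∀ j, inner ℂ (φ j) g = 0) → ∃ h : g ∈ A.domain, A ⟨g, h⟩ = 0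

namespace IsSpectralFamily

variable {A : H →ₗ.[ℂ] K} {lam : ι → ℝ} {φ : ι → H} (h : A.IsSpectralFamily lam φ)
include h

theorem sqrt_pos (j : ι) : 0 < √(lam j) := Real.sqrt_pos.2 (h.pos j)

theorem sqrt_mul_sqrt (j : ι) : (√(lam j) : ℂ) * √(lam j) = lam j := by
  rw [← Complex.ofReal_mul, Real.mul_self_sqrt (h.pos j).le]

theorem sqrt_ne_zero (j : ι) : (√(lam j) : ℂ) ≠ 0 := by
  exact_mod_cast (h.sqrt_pos j).ne'

theorem orthonormal_apply :
    Orthonormal ℂ fun j => ((√(lam j))⁻¹ : ℂ) • A ⟨φ j, h.mem_domain j⟩ := by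
  classical
  rw [orthonormal_iff_ite]
  intro i j
  rw [inner_smul_left, inner_smul_right, h.inner_apply, orthonormal_iff_ite.1 h.orthonormal,
    ← Complex.ofReal_inv, Complex.conj_ofReal]
  split_ifs with hij
  · subst hij
    rw [← h.sqrt_mul_sqrt, mul_one, Complex.ofReal_inv]
    have := h.sqrt_ne_zero i
    field_simp
  · simp

theorem inner_apply_adjoint [CompleteSpace H] (j : ι) (ω : A.adjoint.domain) :
    inner ℂ (φ j) (A.adjoint ω) = inner ℂ (A ⟨φ j, h.mem_domain j⟩) (ω : K) := by
  rw [← inner_conj_symm, A.adjoint_isFormalAdjoint h.dense ω ⟨φ j, h.mem_domain j⟩,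
    inner_conj_symm]

theorem adjoint_apply [CompleteSpace H] (j : ι) : ∃ hj : A ⟨φ j, h.mem_domain j⟩ ∈ A.adjoint.domain,
    A.adjoint ⟨_, hj⟩ = (lam j : ℂ) • φ j := by
  have h1 : ∀ x : A.domain, inner ℂ ((lam j : ℂ) • φ j) (x : H) =
      inner ℂ (A ⟨φ j, h.mem_domain j⟩) (A x) := fun x => by
    rw [h.inner_apply, inner_smul_left, Complex.conj_ofReal]
  have hj := A.mem_adjoint_domain_of_exists _ ⟨_, h1⟩
  exact ⟨hj, LinearPMap.adjoint_apply_eq h.dense ⟨_, hj⟩ h1⟩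

/-- The terms are those of the Bessel expansion of Ax along the normalized Aφ_j, so the series
converges. Closedness identifies its sum with Ay, where y is the projection of x to the closed span
of the φ_j, and A(x - y) = 0. -/
theorem hasSum_apply [CompleteSpace H] [CompleteSpace K] (x : A.domain) :
    HasSum (fun j => inner ℂ (φ j) (x : H) • A ⟨φ j, h.mem_domain j⟩) (A x) := by
  obtain ⟨y, hy, hxy⟩ := h.orthonormal.exists_hasSum_inner (x : H)
  obtain ⟨hg, hg0⟩ := h.apply_eq_zero _ hxy
  obtain ⟨η, hη, -⟩ := h.orthonormal_apply.exists_hasSum_inner (A x)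
  have hη' : HasSum (fun j => inner ℂ (φ j) (x : H) • A ⟨φ j, h.mem_domain j⟩) η := by
    convert hη using 2 with j
    rw [inner_smul_left, h.inner_apply, smul_smul, ← Complex.ofReal_inv, Complex.conj_ofReal,
      ← h.sqrt_mul_sqrt, Complex.ofReal_inv]
    congr 1
    have := h.sqrt_ne_zero j
    field_simp
  have hmem : (y, η) ∈ A.graph := by
    refine h.closed.mem_of_tendsto (hy.prodMk hη') (Eventually.of_forall fun s => ?_)
    refine A.graph.sum_mem fun j _ => ?_
    exact A.graph.smul_mem _ (A.mem_graph ⟨φ j, h.mem_domain j⟩)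
  have hmem2 : (y, A x) ∈ A.graph := by
    have := A.graph.sub_mem (A.mem_graph x) (A.mem_graph ⟨_, hg⟩)
    rw [hg0] at this
    simpa using this
  have := LinearPMap.mem_graph_snd_inj _ hmem2 hmem rfl
  exact this ▸ hη'

/-- A†ω is orthogonal to ker A, which contains the orthogonal complement of the φ_j. -/
theorem hasSum_adjoint [CompleteSpace H] (ω : A.adjoint.domain) :
    HasSum (fun j => inner ℂ (φ j) (A.adjoint ω) • φ j) (A.adjoint ω) := by
  refine h.orthonormal.hasSum_inner_of_forall fun g hg => ?_
  obtain ⟨hd, h0⟩ := h.apply_eq_zero g hg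
  rw [← inner_conj_symm, A.adjoint_isFormalAdjoint h.dense ω ⟨g, hd⟩, h0, inner_zero_right]
  exact RingHom.map_zero _

end IsSpectralFamily

end LinearPMap

end Hilbert

/-! ### Passing from real to complex spaces. -/

section Complexification

theorem norm_add_I_smul_sq {H : Type*} [NormedAddCommGroup H] [InnerProductSpace ℂ H]
    {a b : H} (h : (inner ℂ a b : ℂ).im = 0) :
    ‖a + Complex.I • b‖ ^ 2 = ‖a‖ ^ 2 + ‖b‖ ^ 2 := by
  rw [@norm_add_sq ℂ, inner_smul_right, norm_smul, Complex.norm_I, one_mul]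
  simp [h]

section Span

variable {V W : Type*} [NormedAddCommGroup V] [NormedSpace ℝ V] [NormedAddCommGroup W]
  [NormedSpace ℂ W] [NormedSpace ℝ W] [IsScalarTower ℝ ℂ W]

/-- The complex span `{Ψ u + i Ψ v}` of the range of a real linear map `Ψ`. -/
def complexSpan (Ψ : V →L[ℝ] W) : Submodule ℂ W where
  carrier := {p | ∃ u v, p = Ψ u + Complex.I • Ψ v}
  zero_mem' := ⟨0, 0, by simp⟩
  add_mem' := by
    rintro _ _ ⟨u, v, rfl⟩ ⟨u', v', rfl⟩
    exact ⟨u + u', v + v', by simp only [map_add, smul_add]; abel⟩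
  smul_mem' := by
    rintro c _ ⟨u, v, rfl⟩
    refine ⟨c.re • u - c.im • v, c.im • u + c.re • v, ?_⟩
    have hr : ∀ (r : ℝ) (w : W), r • w = (r : ℂ) • w := fun r w => (algebraMap_smul ℂ r w).symm
    simp only [map_add, map_sub, map_smul, hr]
    conv_lhs => rw [← Complex.re_add_im c]
    have h : (c.im : ℂ) * Complex.I * Complex.I = -c.im := by
      rw [mul_assoc, Complex.I_mul_I]; ring
    simp only [smul_add, smul_smul, add_mul, h, add_smul]
    rw [mul_comm (c.re : ℂ) Complex.I, mul_comm (c.im : ℂ) Complex.I, neg_smul]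
    abel

/-- The map (u, v) ↦ Ψu + iΨv is continuous and bounded below, so it has closed range. The factor 2
accommodates the maximum norm on a product target. -/
theorem isClosed_complexSpan [CompleteSpace V] {Ψ : V →L[ℝ] W}
    (h : ∀ u v, ‖u‖ ^ 2 + ‖v‖ ^ 2 ≤ 2 * ‖Ψ u + Complex.I • Ψ v‖ ^ 2) :
    IsClosed (complexSpan Ψ : Set W) := by
  let Φ : (V × V) →+ W :=
    { toFun := fun z => Ψ z.1 + Complex.I • Ψ z.2
      map_zero' := by simp
      map_add' := fun z w => by simp only [Prod.fst_add, Prod.snd_add, map_add, smul_add]; abel }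
  have hanti : AntilipschitzWith 2 Φ := by
    refine AddMonoidHomClass.antilipschitz_of_bound Φ fun z => ?_
    have h := h z.1 z.2
    change ‖z‖ ≤ 2 * ‖Ψ z.1 + Complex.I • Ψ z.2‖
    set p := Ψ z.1 + Complex.I • Ψ z.2
    refine max_le ?_ ?_
    · refine (sq_le_sq₀ (norm_nonneg _) (by positivity)).1 ?_
      nlinarith [sq_nonneg ‖z.2‖, sq_nonneg ‖p‖]
    · refine (sq_le_sq₀ (norm_nonneg _) (by positivity)).1 ?_
      nlinarith [sq_nonneg ‖z.1‖, sq_nonneg ‖p‖]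
  have hcont : Continuous Φ := by
    change Continuous fun z : V × V => Ψ z.1 + Complex.I • Ψ z.2
    fun_prop
  convert hanti.isClosed_range (uniformContinuous_addMonoidHom_of_continuous hcont) using 1
  refine Set.ext fun p => ⟨?_, ?_⟩
  · rintro ⟨u, v, rfl⟩; exact ⟨(u, v), rfl⟩
  · rintro ⟨z, rfl⟩; exact ⟨z.1, z.2, rfl⟩

end Span

variable {X : Type*} [MeasurableSpace X] {μ : Measure X}

theorem coeFn_lpOfReal (u : Lp ℝ 2 μ) : lpOfReal μ u =ᵐ[μ] fun x => (u x : ℂ) :=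
  Complex.ofRealCLM.coeFn_compLpL u

theorem inner_lpOfReal (u v : Lp ℝ 2 μ) :
    inner ℂ (lpOfReal μ u) (lpOfReal μ v) = (inner ℝ u v : ℂ) := by
  rw [L2.inner_def, L2.inner_def]
  refine Eq.trans (integral_congr_ae ?_) integral_ofReal
  filter_upwards [coeFn_lpOfReal u, coeFn_lpOfReal v] with x h1 h2
  rw [h1, h2]
  simp [RCLike.inner_apply]

theorem norm_lpOfReal_sq (u : Lp ℝ 2 μ) : ‖lpOfReal μ u‖ ^ 2 = ‖u‖ ^ 2 := by
  rw [← @inner_self_eq_norm_sq ℂ, inner_lpOfReal, real_inner_self_eq_norm_sq]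
  rfl

theorem exists_eq_lpOfReal_add (f : Lp ℂ 2 μ) :
    ∃ u v : Lp ℝ 2 μ, f = lpOfReal μ u + Complex.I • lpOfReal μ v := by
  refine ⟨Complex.reCLM.compLp f, Complex.imCLM.compLp f, ?_⟩
  refine Lp.ext ?_
  filter_upwards [Lp.coeFn_add (lpOfReal μ (Complex.reCLM.compLp f))
    (Complex.I • lpOfReal μ (Complex.imCLM.compLp f)),
    Lp.coeFn_smul Complex.I (lpOfReal μ (Complex.imCLM.compLp f)),
    coeFn_lpOfReal (Complex.reCLM.compLp f), coeFn_lpOfReal (Complex.imCLM.compLp f),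
    Complex.reCLM.coeFn_compLp f, Complex.imCLM.coeFn_compLp f] with x h1 h2 h3 h4 h5 h6
  rw [h1, Pi.add_apply, h2, Pi.smul_apply, h3, h4, h5, h6, smul_eq_mul, mul_comm]
  exact (Complex.re_add_im _).symm

end Complexification

/-! ### The complex gradient, the generator, and the spectral decomposition of 𝔻. -/

namespace DirichletForm

variable {X : Type*} [TopologicalSpace X] [MeasurableSpace X] [BorelSpace X] {μ : Measure X}
  [IsFiniteMeasureOnCompacts μ] {E : DirichletForm μ}

/-- `D` is the real gradient on the form domain. -/
structure IsDerivative (D : E.FormSpace →L[ℝ] E.OneForm) : Prop where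
  regular : E.IsRegular
  isGradient : ∀ a : E.core, E.IsGradient a (D (FormSpace.ofDomain E (E.coreToDomain a)))
  inner_eq : ∀ u v : E.domain, inner ℂ (D (FormSpace.ofDomain E u)) (D (FormSpace.ofDomain E v)) =
      (E.form u v : ℂ)

/-- The map `u ↦ (u, ∂u)` on the real form domain. -/
def graphMap (D : E.FormSpace →L[ℝ] E.OneForm) : E.FormSpace →L[ℝ] Lp ℂ 2 μ × E.OneForm :=
  ((lpOfReal μ).comp (FormSpace.toLp E)).prod D

namespace IsDerivative

variable {D : E.FormSpace →L[ℝ] E.OneForm} (hD : IsDerivative D)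
include hD

theorem norm_sq_le (u v : E.FormSpace) : ‖u‖ ^ 2 + ‖v‖ ^ 2 ≤
    2 * ‖graphMap D u + Complex.I • graphMap D v‖ ^ 2 := by
  have hnorm : ∀ w : E.FormSpace, ‖w‖ ^ 2 = ‖D w‖ ^ 2 + ‖lpOfReal μ (FormSpace.toLp E w)‖ ^ 2 :=
    fun w => by
      have h1 : ‖D w‖ ^ 2 = E.form ((FormSpace.ofDomain E).symm w)
          ((FormSpace.ofDomain E).symm w) := by
        have h := hD.inner_eq ((FormSpace.ofDomain E).symm w) ((FormSpace.ofDomain E).symm w)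
        rw [LinearEquiv.apply_symm_apply] at h
        rw [← @inner_self_eq_norm_sq ℂ _ _ _ _ (D w), h]
        rfl
      rw [h1, norm_lpOfReal_sq]
      exact FormSpace.norm_sq E ((FormSpace.ofDomain E).symm w)
  have h1 := hnorm u
  have h2 := hnorm v
  set p := graphMap D u + Complex.I • graphMap D v with hp
  have h3 : ‖p.1‖ ^ 2 = ‖lpOfReal μ (FormSpace.toLp E u)‖ ^ 2 +
      ‖lpOfReal μ (FormSpace.toLp E v)‖ ^ 2 := norm_add_I_smul_sq
    (a := lpOfReal μ (FormSpace.toLp E u)) (b := lpOfReal μ (FormSpace.toLp E v)) (by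
      rw [inner_lpOfReal]; exact Complex.ofReal_im _)
  have h4 : ‖p.2‖ ^ 2 = ‖D u‖ ^ 2 + ‖D v‖ ^ 2 := norm_add_I_smul_sq (a := D u) (b := D v) (by
    have h := hD.inner_eq ((FormSpace.ofDomain E).symm u) ((FormSpace.ofDomain E).symm v)
    rw [LinearEquiv.apply_symm_apply, LinearEquiv.apply_symm_apply] at h
    rw [h]
    exact Complex.ofReal_im _)
  have h5 : ‖p.1‖ ^ 2 ≤ ‖p‖ ^ 2 := by gcongr; exact norm_fst_le p
  have h6 : ‖p.2‖ ^ 2 ≤ ‖p‖ ^ 2 := by gcongr; exact norm_snd_le p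
  linarith

theorem isClosed_complexSpan : _root_.IsClosed (complexSpan (graphMap D) : Set (Lp ℂ 2 μ × E.OneForm)) :=
  _root_.isClosed_complexSpan hD.norm_sq_le

/-- The right side is closed and contains the generators; conversely the graph over 𝓕 is reached
from 𝓒 by 𝓔₁-density. -/
theorem topologicalClosure_eq : (Submodule.span ℂ {p : Lp ℂ 2 μ × E.OneForm |
    ∃ a : E.core, p.1 = lpOfReal μ (ccToLp μ a) ∧ E.IsGradient a p.2}).topologicalClosure =
      complexSpan (graphMap D) := by
  refine le_antisymm (Submodule.topologicalClosure_minimal _ (Submodule.span_le.2 ?_)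
    hD.isClosed_complexSpan) ?_
  · rintro ⟨f, η⟩ ⟨a, ha, hη⟩
    refine ⟨FormSpace.ofDomain E (E.coreToDomain a), 0, ?_⟩
    rw [map_zero, smul_zero, add_zero]
    exact Prod.ext ha (hη.unique (hD.isGradient a))
  · set S := (Submodule.span ℂ {p : Lp ℂ 2 μ × E.OneForm |
      ∃ a : E.core, p.1 = lpOfReal μ (ccToLp μ a) ∧ E.IsGradient a p.2}).topologicalClosure
    have key : ∀ u, graphMap D u ∈ S := fun u => by
      have hcl : _root_.IsClosed {u : E.FormSpace | graphMap D u ∈ S} :=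
        (Submodule.isClosed_topologicalClosure _).preimage (graphMap D).continuous
      refine hcl.closure_subset_iff.2 subset_rfl (Metric.mem_closure_iff.2 fun ε hε => ?_)
      obtain ⟨g, hg⟩ := hD.regular.2 ((FormSpace.ofDomain E).symm u) (ε ^ 2) (by positivity)
      refine ⟨FormSpace.ofDomain E (E.coreToDomain g), ?_, ?_⟩
      · exact Submodule.le_topologicalClosure _
          (Submodule.subset_span ⟨g, rfl, hD.isGradient g⟩)
      · have h2 := FormSpace.norm_sq E ((FormSpace.ofDomain E).symm u - E.coreToDomain g)
        rw [map_sub, LinearEquiv.apply_symm_apply] at h2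
        rw [dist_eq_norm]
        exact lt_of_pow_lt_pow_left₀ 2 hε.le (h2.trans_lt hg)
    rintro _ ⟨u, v, rfl⟩
    exact S.add_mem (key u) (S.smul_mem _ (key v))

/-- What has to be checked is closability: if u + iv = 0 in L² with u, v real, then u = v = 0, and
so the second component vanishes too. -/
theorem graph_grad : E.grad.graph = complexSpan (graphMap D) := by
  rw [← hD.topologicalClosure_eq]
  refine Submodule.toLinearPMap_graph_eq _ ?_
  rw [hD.topologicalClosure_eq]
  rintro _ ⟨u, v, rfl⟩ h0
  have h3 : (0 : ℝ) = ‖lpOfReal μ (FormSpace.toLp E u)‖ ^ 2 +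
      ‖lpOfReal μ (FormSpace.toLp E v)‖ ^ 2 := by
    rw [← norm_add_I_smul_sq (by rw [inner_lpOfReal]; exact Complex.ofReal_im _)]
    change (0 : ℝ) = ‖(graphMap D u + Complex.I • graphMap D v).1‖ ^ 2
    rw [h0, norm_zero]; norm_num
  have inj : ∀ w : E.FormSpace, ‖lpOfReal μ (FormSpace.toLp E w)‖ ^ 2 ≤ 0 → w = 0 := fun w hw => by
    rw [norm_lpOfReal_sq] at hw
    have h1 : FormSpace.toLp E w = 0 :=
      norm_eq_zero.1 (pow_eq_zero_iff two_ne_zero |>.1 (le_antisymm hw (sq_nonneg _)))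
    have h2 : (FormSpace.ofDomain E).symm w = 0 := Subtype.ext h1
    exact (LinearEquiv.map_eq_zero_iff _).1 h2
  rw [inj u (by linarith [sq_nonneg ‖lpOfReal μ (FormSpace.toLp E v)‖]),
    inj v (by linarith [sq_nonneg ‖lpOfReal μ (FormSpace.toLp E u)‖])]
  simp

theorem mem_graph_grad (u v : E.domain) :
    (lpOfReal μ u + Complex.I • lpOfReal μ v, D (FormSpace.ofDomain E u) +
      Complex.I • D (FormSpace.ofDomain E v)) ∈ E.grad.graph := by
  rw [hD.graph_grad]
  exact ⟨FormSpace.ofDomain E u, FormSpace.ofDomain E v, rfl⟩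

theorem grad_apply (u v : E.domain) :
    ∃ h : lpOfReal μ u + Complex.I • lpOfReal μ v ∈ E.grad.domain,
      E.grad ⟨_, h⟩ = D (FormSpace.ofDomain E u) + Complex.I • D (FormSpace.ofDomain E v) := by
  have h := hD.mem_graph_grad u v
  have hd := LinearPMap.mem_domain_of_mem_graph h
  exact ⟨hd, LinearPMap.mem_graph_snd_inj _ (E.grad.mem_graph ⟨_, hd⟩) h rfl⟩

theorem exists_eq_of_mem_domain (x : E.grad.domain) : ∃ u v : E.domain,
    (x : Lp ℂ 2 μ) = lpOfReal μ u + Complex.I • lpOfReal μ v ∧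
      E.grad x = D (FormSpace.ofDomain E u) + Complex.I • D (FormSpace.ofDomain E v) := by
  have h := E.grad.mem_graph x
  rw [hD.graph_grad] at h
  obtain ⟨u, v, huv⟩ := h
  exact ⟨(FormSpace.ofDomain E).symm u, (FormSpace.ofDomain E).symm v, congrArg Prod.fst huv,
    congrArg Prod.snd huv⟩

theorem dense_domain_grad : Dense (E.grad.domain : Set (Lp ℂ 2 μ)) := by
  have h1 : Continuous fun z : Lp ℝ 2 μ × Lp ℝ 2 μ =>
      lpOfReal μ z.1 + Complex.I • lpOfReal μ z.2 := by fun_prop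
  have h2 : Function.Surjective fun z : Lp ℝ 2 μ × Lp ℝ 2 μ =>
      lpOfReal μ z.1 + Complex.I • lpOfReal μ z.2 := fun f => by
    obtain ⟨u, v, h⟩ := exists_eq_lpOfReal_add f
    exact ⟨(u, v), h.symm⟩
  refine (h2.denseRange.dense_image h1 (E.dense_domain.prod E.dense_domain)).mono ?_
  rintro _ ⟨⟨u, v⟩, ⟨hu, hv⟩, rfl⟩
  exact (hD.grad_apply ⟨u, hu⟩ ⟨v, hv⟩).choose

theorem span_generator_le {p : Lp ℂ 2 μ × Lp ℂ 2 μ}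
    (hp : p ∈ Submodule.span ℂ {p : Lp ℂ 2 μ × Lp ℂ 2 μ | ∃ (g : E.domain) (h : Lp ℝ 2 μ),
      (∀ f : E.domain, E.form f g = -inner ℝ (f : Lp ℝ 2 μ) h) ∧
      p = (lpOfReal μ g, lpOfReal μ h)}) :
    ∃ h : p.1 ∈ E.grad.domain, ∀ x : E.grad.domain,
      inner ℂ (E.grad ⟨p.1, h⟩) (E.grad x) = -inner ℂ p.2 (x : Lp ℂ 2 μ) := by
  induction hp using Submodule.span_induction with
  | mem p hp =>
    obtain ⟨g, h, hgh, rfl⟩ := hp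
    have hg := hD.grad_apply g 0
    simp only [Submodule.coe_zero, map_zero, smul_zero, add_zero] at hg
    obtain ⟨hd, hg⟩ := hg
    refine ⟨hd, fun x => ?_⟩
    obtain ⟨u, v, hx, hx'⟩ := hD.exists_eq_of_mem_domain x
    rw [hg, hx, hx', inner_add_right, inner_smul_right, hD.inner_eq, hD.inner_eq, E.symm, E.symm g,
      hgh, hgh, inner_add_right, inner_smul_right, inner_lpOfReal, inner_lpOfReal,
      real_inner_comm h, real_inner_comm h]
    push_cast
    ring
  | zero =>
    refine ⟨E.grad.domain.zero_mem, fun x => ?_⟩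
    have : E.grad ⟨0, E.grad.domain.zero_mem⟩ = 0 := E.grad.map_zero
    simp only [Prod.fst_zero, Prod.snd_zero, inner_zero_left, neg_zero, this]
  | add p q _ _ hp hq =>
    obtain ⟨hp, hp'⟩ := hp
    obtain ⟨hq, hq'⟩ := hq
    refine ⟨E.grad.domain.add_mem hp hq, fun x => ?_⟩
    have : E.grad ⟨(p + q).1, E.grad.domain.add_mem hp hq⟩ = E.grad ⟨p.1, hp⟩ + E.grad ⟨q.1, hq⟩ :=
      E.grad.map_add ⟨p.1, hp⟩ ⟨q.1, hq⟩
    rw [this, inner_add_left, hp', hq', Prod.snd_add, inner_add_left]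
    ring
  | smul c p _ hp =>
    obtain ⟨hp, hp'⟩ := hp
    refine ⟨E.grad.domain.smul_mem c hp, fun x => ?_⟩
    have : E.grad ⟨(c • p).1, E.grad.domain.smul_mem c hp⟩ = c • E.grad ⟨p.1, hp⟩ :=
      E.grad.map_smul c ⟨p.1, hp⟩
    rw [this, inner_smul_left, hp', Prod.smul_snd, inner_smul_left]
    ring

/-- The relation is single valued: if the first entry is zero, the second is orthogonal to the dense
domain of ∂. -/
theorem graph_generator : E.generator.graph =
    Submodule.span ℂ {p : Lp ℂ 2 μ × Lp ℂ 2 μ | ∃ (g : E.domain) (h : Lp ℝ 2 μ),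
      (∀ f : E.domain, E.form f g = -inner ℝ (f : Lp ℝ 2 μ) h) ∧
      p = (lpOfReal μ g, lpOfReal μ h)} := by
  refine Submodule.toLinearPMap_graph_eq _ fun p hp h0 => ?_
  obtain ⟨h, hin⟩ := hD.span_generator_le hp
  refine hD.dense_domain_grad.eq_zero_of_inner_left ℂ fun x hx => ?_
  have h1 := hin ⟨x, hx⟩
  have h2 : E.grad ⟨p.1, h⟩ = 0 := by
    have : (⟨p.1, h⟩ : E.grad.domain) = 0 := Subtype.ext h0
    rw [this, E.grad.map_zero]
  rw [h2, inner_zero_left] at h1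
  exact neg_eq_zero.1 h1.symm

/-- The generator is `-∂* ∂`, in the weak sense. -/
theorem inner_grad_generator (f : E.generator.domain) :
    ∃ h : (f : Lp ℂ 2 μ) ∈ E.grad.domain, ∀ x : E.grad.domain,
      inner ℂ (E.grad ⟨f, h⟩) (E.grad x) = -inner ℂ (E.generator f) (x : Lp ℂ 2 μ) := by
  have h := E.generator.mem_graph f
  rw [hD.graph_generator] at h
  exact hD.span_generator_le h

/-- A vector orthogonal to the range of the generator is in the kernel of the gradient. -/
theorem grad_eq_zero (g : Lp ℂ 2 μ) (hg : ∀ f, inner ℂ (E.generator f) g = 0) :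
    ∃ h : g ∈ E.grad.domain, E.grad ⟨g, h⟩ = 0 := by
  obtain ⟨T, hT⟩ := E.exists_isResolvent_one
  -- The range of L contains Tu - u = L(Tu) for every real u.
  have hgen : ∀ u : Lp ℝ 2 μ, inner ℂ (lpOfReal μ (T u - u : Lp ℝ 2 μ)) g = 0 := fun u => by
    have hmem : (lpOfReal μ (T u), lpOfReal μ (T u - u : Lp ℝ 2 μ)) ∈ E.generator.graph := by
      rw [hD.graph_generator]
      refine Submodule.subset_span ⟨T u, _, fun f => ?_, rfl⟩
      rw [E.symm, hT, one_mul, real_inner_comm, ← inner_neg_right, neg_sub]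
    obtain ⟨y, -, hy⟩ := (LinearPMap.mem_graph_iff _).1 hmem
    change E.generator y = lpOfReal μ (T u - u : Lp ℝ 2 μ) at hy
    rw [← hy]
    exact hg y
  obtain ⟨u, v, rfl⟩ := exists_eq_lpOfReal_add g
  -- Here 𝓔(Tw, Tw) + ‖w - Tw‖² = ⟨w - Tw, w⟩ = 0, so both terms vanish. It is applied to the real
  -- and imaginary parts of g.
  have hreal : ∀ w : Lp ℝ 2 μ, inner ℝ (T w - w : Lp ℝ 2 μ) w = 0 →
      (T w : Lp ℝ 2 μ) = w ∧ D (FormSpace.ofDomain E (T w)) = 0 := fun w hw => by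
    have h1 := hT.form_self w
    have h2 : inner ℝ (w - T w : Lp ℝ 2 μ) w = 0 := by
      rw [← neg_sub, inner_neg_left, hw, neg_zero]
    rw [h2, mul_zero, one_mul] at h1
    have h3 := E.nonneg (T w)
    have h4 := sq_nonneg ‖(w - T w : Lp ℝ 2 μ)‖
    constructor
    · exact (sub_eq_zero.1 (norm_eq_zero.1 (pow_eq_zero_iff two_ne_zero |>.1
        (by linarith : ‖(w - T w : Lp ℝ 2 μ)‖ ^ 2 = 0)))).symm
    · rw [← inner_self_eq_zero (𝕜 := ℂ), hD.inner_eq, Complex.ofReal_eq_zero]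
      linarith
  have hu := hgen u
  have hv := hgen v
  rw [inner_add_right, inner_smul_right, inner_lpOfReal, inner_lpOfReal] at hu hv
  obtain ⟨hu1, hu2⟩ := hreal u (by simpa using congrArg Complex.re hu)
  obtain ⟨hv1, hv2⟩ := hreal v (by simpa using congrArg Complex.im hv)
  obtain ⟨h, h'⟩ := hD.grad_apply (T u) (T v)
  simp only [hu1, hv1] at h h'
  refine ⟨h, ?_⟩
  rw [h', hu2, hv2, smul_zero, add_zero]

theorem isSpectralFamily {ι : Type*} {lam : ι → ℝ} {φ : ι → Lp ℂ 2 μ}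
    (h : E.HasPurePointSpectrum lam φ) : E.grad.IsSpectralFamily lam φ where
  dense := hD.dense_domain_grad
  closed := by rw [hD.graph_grad]; exact hD.isClosed_complexSpan
  pos := h.pos
  orthonormal := h.orthonormal
  mem_domain j := by
    obtain ⟨hj, -⟩ := h.eigen j
    exact (hD.inner_grad_generator ⟨φ j, hj⟩).choose
  inner_apply j u := by
    obtain ⟨hj, he⟩ := h.eigen j
    obtain ⟨hd, hin⟩ := hD.inner_grad_generator ⟨φ j, hj⟩
    refine (hin u).trans ?_
    rw [← inner_neg_left, he, inner_smul_left, Complex.conj_ofReal]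
  apply_eq_zero g hg := by
    refine hD.grad_eq_zero g fun f => ?_
    have h1 := (innerSL ℂ g).hasSum (h.hasSum f)
    have h2 : innerSL ℂ g (-E.generator f) = 0 := by
      refine h1.unique ?_
      convert hasSum_zero using 2 with j
      rw [innerSL_apply_apply, inner_smul_right, inner_eq_zero_symm.1 (hg j), mul_zero]
    rw [innerSL_apply_apply, inner_neg_right, neg_eq_zero] at h2
    exact inner_eq_zero_symm.1 h2

end IsDerivative

theorem exists_isDerivative [R1Space X] [LocallyCompactSpace X] [SigmaCompactSpace X]
    (hreg : E.IsRegular) (hkill : E.HasNoKilling) :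
    ∃ D : E.FormSpace →L[ℝ] E.OneForm, IsDerivative D := by
  obtain ⟨D, h1, h2⟩ := exists_derivative hreg hkill
  exact ⟨D, hreg, h1, h2⟩

/-- The spectral decomposition of the Dirac operator. -/
theorem dirac_spectral {ι : Type*} {lam : ι → ℝ} {φ : ι → Lp ℂ 2 μ}
    (h : E.grad.IsSpectralFamily lam φ) {v w : ι → WithLp 2 (Lp ℂ 2 μ × E.OneForm)}
    (hv : ∀ j, v j = (1 / √2 : ℂ) •
      WithLp.toLp 2 (φ j, ((√(lam j))⁻¹ : ℂ) • E.grad ⟨φ j, h.mem_domain j⟩))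
    (hw : ∀ j, w j = (1 / √2 : ℂ) •
      WithLp.toLp 2 (φ j, -((√(lam j))⁻¹ : ℂ) • E.grad ⟨φ j, h.mem_domain j⟩)) :
    Orthonormal ℂ (Sum.elim v w) ∧
    (∀ j, ∃ h : v j ∈ E.dirac.domain, E.dirac ⟨v j, h⟩ = (√(lam j) : ℂ) • v j) ∧
    (∀ j, ∃ h : w j ∈ E.dirac.domain, E.dirac ⟨w j, h⟩ = (-√(lam j) : ℂ) • w j) ∧
    ∀ x : E.dirac.domain, ∃ y z : WithLp 2 (Lp ℂ 2 μ × E.OneForm),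
      HasSum (fun j => ((√(lam j) : ℂ) *
        inner ℂ (v j) (x : WithLp 2 (Lp ℂ 2 μ × E.OneForm))) • v j) y ∧
      HasSum (fun j => ((√(lam j) : ℂ) *
        inner ℂ (w j) (x : WithLp 2 (Lp ℂ 2 μ × E.OneForm))) • w j) z ∧
      E.dirac x = y - z := by
  have horth : Orthonormal ℂ (Sum.elim v w) := by
    convert h.orthonormal.sumElim_toLp h.orthonormal_apply using 2
    · exact funext hv
    · refine funext fun j => ?_
      rw [hw, neg_smul]
  -- The sign s = ±1 treats both families at once, and c is the normalization.
  have heig : ∀ (c : ℂ) (s : ℂ), s * s = 1 → ∀ j, ∃ h' : c • WithLp.toLp 2 (φ j,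
      (s * (√(lam j) : ℂ)⁻¹) • E.grad ⟨φ j, h.mem_domain j⟩) ∈ E.dirac.domain,
      E.dirac ⟨_, h'⟩ = (s * √(lam j) : ℂ) • c • WithLp.toLp 2 (φ j,
      (s * (√(lam j) : ℂ)⁻¹) • E.grad ⟨φ j, h.mem_domain j⟩) := by
    intro c s hs j
    obtain ⟨hj, hj'⟩ := h.adjoint_apply j
    have hmem : WithLp.toLp 2 (φ j, (s * (√(lam j) : ℂ)⁻¹) • E.grad ⟨φ j, h.mem_domain j⟩) ∈
        E.dirac.domain := ⟨h.mem_domain j, E.gradAdjoint.domain.smul_mem _ hj⟩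
    refine ⟨E.dirac.domain.smul_mem c hmem, ?_⟩
    have e1 : E.dirac ⟨_, hmem⟩ = (s * √(lam j) : ℂ) • WithLp.toLp 2 (φ j,
        (s * (√(lam j) : ℂ)⁻¹) • E.grad ⟨φ j, h.mem_domain j⟩) := by
      have e2 : E.gradAdjoint ⟨_, E.gradAdjoint.domain.smul_mem (s * (√(lam j) : ℂ)⁻¹) hj⟩ =
          (s * √(lam j) : ℂ) • φ j := by
        refine (E.gradAdjoint.map_smul (s * (√(lam j) : ℂ)⁻¹) ⟨_, hj⟩).trans ?_
        have : E.gradAdjoint ⟨_, hj⟩ = (lam j : ℂ) • φ j := hj'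
        rw [this, smul_smul, ← h.sqrt_mul_sqrt]
        congr 1
        have := h.sqrt_ne_zero j
        field_simp
      have e3 : E.grad ⟨φ j, h.mem_domain j⟩ =
          (s * √(lam j) : ℂ) • (s * (√(lam j) : ℂ)⁻¹) • E.grad ⟨φ j, h.mem_domain j⟩ := by
        have h0 := h.sqrt_ne_zero j
        have : (s * √(lam j) : ℂ) * (s * (√(lam j) : ℂ)⁻¹) = 1 := by
          field_simp
          rw [sq, hs]
        rw [smul_smul, this, one_smul]
      exact congrArg (WithLp.toLp 2) (Prod.ext e2 e3)
    rw [smul_comm, ← e1]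
    exact E.dirac.map_smul c ⟨_, hmem⟩
  refine ⟨horth, fun j => ?_, fun j => ?_, fun x => ?_⟩
  · have := heig (1 / √2) 1 (one_mul 1) j
    simpa only [one_mul, ← hv] using this
  · have := heig (1 / √2) (-1) (by ring) j
    simpa only [neg_mul, one_mul, ← hw] using this
  · have hov : Orthonormal ℂ v := horth.comp Sum.inl Sum.inl_injective
    have how : Orthonormal ℂ w := horth.comp Sum.inr Sum.inr_injective
    set f : E.grad.domain := ⟨(x : WithLp 2 (Lp ℂ 2 μ × E.OneForm)).fst, x.2.1⟩ with hf
    set ω : E.gradAdjoint.domain := ⟨(x : WithLp 2 (Lp ℂ 2 μ × E.OneForm)).snd, x.2.2⟩ with hω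
    -- α and β are the coefficients of ∂f along λ_j^{-1/2}∂φ_j and of ∂*ω along φ_j. Both are square
    -- summable by Bessel, and the series for v and w have coefficients (α ± β)/√2.
    set α : ι → ℂ := fun j => √(lam j) * inner ℂ (φ j) (f : Lp ℂ 2 μ) with hα
    set β : ι → ℂ := fun j => inner ℂ (φ j) (E.gradAdjoint ω) with hβ
    have hωin : ∀ j, inner ℂ (E.grad ⟨φ j, h.mem_domain j⟩) (ω : E.OneForm) = β j := fun j =>
      (h.inner_apply_adjoint j ω).symm
    have hvx : ∀ j, (√(lam j) : ℂ) * inner ℂ (v j) (x : WithLp 2 (Lp ℂ 2 μ × E.OneForm)) =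
        (1 / √2 : ℂ) * (α j + β j) := fun j => by
      have : inner ℂ (v j) (x : WithLp 2 (Lp ℂ 2 μ × E.OneForm)) = (1 / √2 : ℂ) *
          (inner ℂ (φ j) (f : Lp ℂ 2 μ) + (√(lam j) : ℂ)⁻¹ * β j) := by
        rw [hv, inner_smul_left, WithLp.prod_inner_apply, ← hωin, map_div₀, Complex.conj_ofReal,
          map_one]
        congr 2
        refine (inner_smul_left _ _ _).trans ?_
        rw [← Complex.ofReal_inv, Complex.conj_ofReal]
        rfl
      rw [this, hα]
      have := h.sqrt_ne_zero j
      field_simp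
    have hwx : ∀ j, (√(lam j) : ℂ) * inner ℂ (w j) (x : WithLp 2 (Lp ℂ 2 μ × E.OneForm)) =
        (1 / √2 : ℂ) * (α j - β j) := fun j => by
      have : inner ℂ (w j) (x : WithLp 2 (Lp ℂ 2 μ × E.OneForm)) = (1 / √2 : ℂ) *
          (inner ℂ (φ j) (f : Lp ℂ 2 μ) - (√(lam j) : ℂ)⁻¹ * β j) := by
        rw [hw, inner_smul_left, WithLp.prod_inner_apply, ← hωin, map_div₀, Complex.conj_ofReal,
          map_one, sub_eq_add_neg, ← neg_mul]
        congr 2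
        refine (inner_smul_left _ _ _).trans ?_
        rw [map_neg, ← Complex.ofReal_inv, Complex.conj_ofReal]
        rfl
      rw [this, hα]
      have := h.sqrt_ne_zero j
      field_simp
    have hαs : Summable fun j => ‖α j‖ ^ 2 := by
      refine (h.orthonormal_apply.inner_products_summable (E.grad f)).congr fun j => ?_
      rw [inner_smul_left, h.inner_apply, ← Complex.ofReal_inv, Complex.conj_ofReal,
        ← h.sqrt_mul_sqrt, hα, Complex.ofReal_inv]
      congr 2
      have := h.sqrt_ne_zero j
      field_simp
    have hβs : Summable fun j => ‖β j‖ ^ 2 := h.orthonormal.inner_products_summable _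
    have hpm : ∀ j, ‖α j + β j‖ ^ 2 + ‖α j - β j‖ ^ 2 = 2 * ‖α j‖ ^ 2 + 2 * ‖β j‖ ^ 2 := fun j => by
      have := parallelogram_law_with_norm ℝ (α j) (β j)
      simp only [sq]
      linarith
    have hsum := (hαs.mul_left 2).add (hβs.mul_left 2)
    have hy : Summable fun j => ((√(lam j) : ℂ) *
        inner ℂ (v j) (x : WithLp 2 (Lp ℂ 2 μ × E.OneForm))) • v j := by
      refine hov.summable_smul ?_
      simp only [hvx, norm_mul, mul_pow]
      refine Summable.mul_left _ (Summable.of_nonneg_of_le (fun j => sq_nonneg _) (fun j => ?_) hsum)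
      rw [← hpm]; exact le_add_of_nonneg_right (sq_nonneg _)
    have hz : Summable fun j => ((√(lam j) : ℂ) *
        inner ℂ (w j) (x : WithLp 2 (Lp ℂ 2 μ × E.OneForm))) • w j := by
      refine how.summable_smul ?_
      simp only [hwx, norm_mul, mul_pow]
      refine Summable.mul_left _ (Summable.of_nonneg_of_le (fun j => sq_nonneg _) (fun j => ?_) hsum)
      rw [← hpm]; exact le_add_of_nonneg_left (sq_nonneg _)
    refine ⟨_, _, hy.hasSum, hz.hasSum, ?_⟩
    have h1 := ((h.hasSum_adjoint ω).prodMk (h.hasSum_apply f)).map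
      (WithLp.prodContinuousLinearEquiv 2 ℂ (Lp ℂ 2 μ) E.OneForm).symm
      (WithLp.prodContinuousLinearEquiv 2 ℂ (Lp ℂ 2 μ) E.OneForm).symm.continuous
    refine HasSum.unique (a₁ := E.dirac x) h1 ?_
    convert hy.hasSum.sub hz.hasSum using 2 with j
    have hs : (1 / √2 : ℂ) * (1 / √2) = 1 / 2 := by
      rw [div_mul_div_comm, ← Complex.ofReal_mul, Real.mul_self_sqrt zero_le_two]
      norm_num
    rw [hvx, hwx, hv, hw, smul_smul, smul_smul, mul_right_comm, mul_right_comm _ (α j - β j), hs]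
    have hα' : α j * (√(lam j) : ℂ)⁻¹ = inner ℂ (φ j) (f : Lp ℂ 2 μ) := by
      have := h.sqrt_ne_zero j
      simp only [hα]
      field_simp
    -- In the difference of the two series, α cancels in the L² component and β in the 𝓗 component.
    refine (WithLp.ofLp_injective 2) (Prod.ext ?_ ?_)
    · change β j • φ j = (1 / 2 * (α j + β j)) • φ j - (1 / 2 * (α j - β j)) • φ j
      rw [← sub_smul]
      congr 1; ring
    · change inner ℂ (φ j) (f : Lp ℂ 2 μ) • E.grad ⟨φ j, h.mem_domain j⟩ =
        (1 / 2 * (α j + β j)) • ((√(lam j) : ℂ)⁻¹ • E.grad ⟨φ j, h.mem_domain j⟩) -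
        (1 / 2 * (α j - β j)) • ((-(√(lam j) : ℂ)⁻¹) • E.grad ⟨φ j, h.mem_domain j⟩)
      rw [smul_smul, smul_smul, ← sub_smul, ← hα']
      congr 1; ring

end DirichletForm

/-! ### A Dirichlet form on the integers, with jumps between `n` and `-1 - n` only -/

namespace ReflectionForm

/-- The counting measure on the integers. -/
abbrev cnt : Measure ℤ := Measure.count

instance : IsFiniteMeasureOnCompacts cnt :=
  ⟨fun _ hK => Measure.count_apply_lt_top.2 hK.finite_of_discrete⟩

instance : Measure.IsOpenPosMeasure cnt :=
  ⟨fun _ _ hU => Measure.count_ne_zero_iff.2 hU⟩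

/-- The reflection of the integers without a fixed point. -/
def refl (n : ℤ) : ℤ := -1 - n

theorem refl_refl (n : ℤ) : refl (refl n) = n := by simp [refl]

theorem refl_injective : Function.Injective refl := Function.LeftInverse.injective refl_refl

theorem measurePreserving_refl : MeasurePreserving refl cnt cnt := by
  refine ⟨Measurable.of_discrete, Measure.ext fun s hs => ?_⟩
  have h : refl ⁻¹' s = refl '' s := by
    ext n
    exact ⟨fun hn => ⟨refl n, hn, refl_refl n⟩, fun ⟨m, hm, hn⟩ => by
      rw [← hn, Set.mem_preimage, refl_refl]; exact hm⟩
  rw [Measure.map_apply Measurable.of_discrete hs, h, Measure.count_injective_image refl_injective]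

/-- Composition with the reflection. -/
def reflLp : Lp ℝ 2 cnt →ₗᵢ[ℝ] Lp ℝ 2 cnt :=
  Lp.compMeasurePreservingₗᵢ ℝ refl measurePreserving_refl

theorem reflLp_apply (u : Lp ℝ 2 cnt) (n : ℤ) : reflLp u n = u (refl n) :=
  Measure.ae_count_iff.1 (Lp.coeFn_compMeasurePreserving u measurePreserving_refl) n

theorem lp_ext {u v : Lp ℝ 2 cnt} (h : ∀ n, u n = v n) : u = v := Lp.ext (ae_of_all _ h)

theorem reflLp_reflLp (u : Lp ℝ 2 cnt) : reflLp (reflLp u) = u :=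
  lp_ext fun n => by rw [reflLp_apply, reflLp_apply, refl_refl]

theorem inner_reflLp (u v : Lp ℝ 2 cnt) : inner ℝ (reflLp u) v = inner ℝ u (reflLp v) := by
  rw [← reflLp.inner_map_map u, reflLp_reflLp]

/-- With R the reflection, R is symmetric and R² = 1, so (1 - R)² = 2(1 - R). -/
theorem inner_sub_reflLp (u v : Lp ℝ 2 cnt) :
    inner ℝ (u - reflLp u) (v - reflLp v) = 2 * inner ℝ (u - reflLp u) v := by
  have h : inner ℝ (reflLp u) (reflLp v) = inner ℝ u v := reflLp.inner_map_map u v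
  rw [inner_sub_right, inner_sub_left, inner_sub_left, h, inner_reflLp]
  ring

/-- The energy of `u`. -/
def energy : (⊤ : Submodule ℝ (Lp ℝ 2 cnt)) →ₗ[ℝ] (⊤ : Submodule ℝ (Lp ℝ 2 cnt)) →ₗ[ℝ] ℝ :=
  LinearMap.mk₂ ℝ (fun u v => inner ℝ ((u : Lp ℝ 2 cnt) - reflLp u) (v : Lp ℝ 2 cnt))
    (fun u u' v => by simp only [Submodule.coe_add, map_add, inner_sub_left, inner_add_left]; ring)
    (fun c u v => by
      simp only [Submodule.coe_smul, map_smul, inner_sub_left, real_inner_smul_left, smul_eq_mul]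
      ring)
    (fun u v v' => by simp only [Submodule.coe_add, inner_add_right])
    (fun c u v => by simp only [Submodule.coe_smul, real_inner_smul_right, smul_eq_mul])

theorem energy_apply (u v : (⊤ : Submodule ℝ (Lp ℝ 2 cnt))) :
    energy u v = inner ℝ ((u : Lp ℝ 2 cnt) - reflLp u) (v : Lp ℝ 2 cnt) := rfl

theorem energy_eq_half (u v : (⊤ : Submodule ℝ (Lp ℝ 2 cnt))) : energy u v =
    inner ℝ ((u : Lp ℝ 2 cnt) - reflLp u) ((v : Lp ℝ 2 cnt) - reflLp v) / 2 := by
  rw [energy_apply, inner_sub_reflLp]; ring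

theorem energy_self (u : (⊤ : Submodule ℝ (Lp ℝ 2 cnt))) :
    energy u u = ‖(u : Lp ℝ 2 cnt) - reflLp u‖ ^ 2 / 2 := by
  rw [energy_eq_half, real_inner_self_eq_norm_sq]

theorem energy_self_le (u : (⊤ : Submodule ℝ (Lp ℝ 2 cnt))) :
    energy u u ≤ 2 * ‖(u : Lp ℝ 2 cnt)‖ ^ 2 := by
  have h : ‖(u : Lp ℝ 2 cnt) - reflLp u‖ ≤ 2 * ‖(u : Lp ℝ 2 cnt)‖ := by
    refine (norm_sub_le _ _).trans ?_
    rw [reflLp.norm_map]; linarith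
  rw [energy_self]
  nlinarith [norm_nonneg ((u : Lp ℝ 2 cnt) - reflLp u)]

/-- The Dirichlet form `𝓔(u, u) = 1/2 ∑ n, (u n - u (-1 - n))²` on `ℓ²(ℤ)`. -/
def form : DirichletForm cnt where
  domain := ⊤
  form := energy
  dense_domain := by simp
  symm u v := by rw [energy_eq_half, energy_eq_half, real_inner_comm]
  nonneg u := by rw [energy_self]; positivity
  closed u hu := by
    have hc : CauchySeq fun n => (u n : Lp ℝ 2 cnt) := by
      refine Metric.cauchySeq_iff.2 fun ε hε => ?_
      obtain ⟨N, hN⟩ := hu (ε ^ 2) (by positivity)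
      refine ⟨N, fun m hm n hn => ?_⟩
      have h1 := hN m hm n hn
      have h2 : 0 ≤ energy (u m - u n) (u m - u n) := by rw [energy_self]; positivity
      rw [dist_eq_norm]
      exact lt_of_pow_lt_pow_left₀ 2 hε.le (by linarith)
    obtain ⟨v, hv⟩ := cauchySeq_tendsto_of_complete hc
    rw [tendsto_iff_norm_sub_tendsto_zero] at hv
    refine ⟨⟨v, trivial⟩, squeeze_zero (fun n => ?_) (fun n => ?_)
      (g := fun n => 3 * ‖(u n : Lp ℝ 2 cnt) - v‖ ^ 2) ?_⟩
    · rw [energy_self]; positivity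
    · have := energy_self_le (u n - ⟨v, trivial⟩)
      simp only [Submodule.coe_sub] at this
      linarith
    · simpa using (hv.pow 2).const_mul 3
  markov u w hw := by
    refine ⟨trivial, ?_⟩
    have hw' := Measure.ae_count_iff.1 hw
    rw [energy_self, energy_self]
    gcongr
    -- The unit contraction is 1-Lipschitz, so each difference u(n) - u(-1 - n) shrinks.
    refine Lp.norm_le_norm_of_ae_le ?_
    filter_upwards [Lp.coeFn_sub w (reflLp w), Lp.coeFn_sub (u : Lp ℝ 2 cnt) (reflLp u)]
      with n h1 h2
    rw [h1, h2, Pi.sub_apply, Pi.sub_apply, reflLp_apply, reflLp_apply, hw', hw',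
      Real.norm_eq_abs, Real.norm_eq_abs]
    refine (abs_min_sub_min_le_max _ _ _ _).trans ?_
    rw [sub_self, abs_zero, max_eq_left (abs_nonneg _)]
    refine (abs_max_sub_max_le_max _ _ _ _).trans ?_
    rw [sub_self, abs_zero, max_eq_right (abs_nonneg _)]

theorem isRegular : form.IsRegular := by
  refine ⟨fun f ε hε => ⟨f, trivial, fun x => by simpa using hε⟩, fun u ε hε => ?_⟩
  -- Since 𝓔₁ ≤ 3‖·‖², an L² error of √(ε/6) leaves at most ε/2.
  obtain ⟨g, hg1, hg2, hg3, hg4⟩ := (Lp.memLp (u : Lp ℝ 2 cnt)).exists_hasCompactSupport_eLpNorm_sub_le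
    (by simp) (ε := ENNReal.ofReal (√(ε / 6))) (by simpa using hε)
  refine ⟨⟨⟨⟨g, hg3⟩, hg1⟩, trivial⟩, ?_⟩
  set G : Lp ℝ 2 cnt := hg4.toLp g with hG
  have h1 : ‖(u : Lp ℝ 2 cnt) - G‖ ≤ √(ε / 6) := by
    rw [Lp.norm_def]
    refine ENNReal.toReal_le_of_le_ofReal (Real.sqrt_nonneg _) (le_trans (le_of_eq ?_) hg2)
    refine eLpNorm_congr_ae ?_
    filter_upwards [Lp.coeFn_sub (u : Lp ℝ 2 cnt) G, hg4.coeFn_toLp] with n e1 e2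
    rw [e1, Pi.sub_apply, Pi.sub_apply, e2]
  have h2 : ‖(u : Lp ℝ 2 cnt) - G‖ ^ 2 ≤ ε / 6 := by
    rw [← Real.sq_sqrt (by positivity : 0 ≤ ε / 6)]; gcongr
  have h3 := energy_self_le ⟨(u : Lp ℝ 2 cnt) - G, trivial⟩
  refine lt_of_le_of_lt (add_le_add_left h3 (‖(u : Lp ℝ 2 cnt) - G‖ ^ 2)) ?_
  linarith

/-- The jump measure: half of the counting measure on the pairs `(n, -1 - n)`. -/
def jump : Measure (ℤ × ℤ) := (2⁻¹ : ℝ≥0∞) • cnt.map fun n => (n, refl n)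

theorem reflLp_ccToLp_sub (u : C_c(ℤ, ℝ)) (n : ℤ) :
    (ccToLp cnt u - reflLp (ccToLp cnt u) : Lp ℝ 2 cnt) n = u n - u (refl n) := by
  rw [Measure.ae_count_iff.1 (Lp.coeFn_sub (ccToLp cnt u) (reflLp (ccToLp cnt u))) n,
    Pi.sub_apply, reflLp_apply, Measure.ae_count_iff.1 (coeFn_ccToLp u),
    Measure.ae_count_iff.1 (coeFn_ccToLp u)]

theorem jump_integrand (u v : C_c(ℤ, ℝ)) (n : ℤ) : (u n - u (refl n)) * (v n - v (refl n)) =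
    inner ℝ ((ccToLp cnt u - reflLp (ccToLp cnt u) : Lp ℝ 2 cnt) n)
      ((ccToLp cnt v - reflLp (ccToLp cnt v) : Lp ℝ 2 cnt) n) := by
  rw [reflLp_ccToLp_sub, reflLp_ccToLp_sub]
  simp [mul_comm]

theorem measurable_pair : Measurable fun n : ℤ => (n, refl n) := Measurable.of_discrete

theorem integrable_jump (u v : C_c(ℤ, ℝ)) :
    Integrable (fun p : ℤ × ℤ => (u p.1 - u p.2) * (v p.1 - v p.2)) jump := by
  refine Integrable.smul_measure ?_ (by simp)
  rw [integrable_map_measure Measurable.of_discrete.aestronglyMeasurable measurable_pair.aemeasurable]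
  refine (L2.integrable_inner (𝕜 := ℝ) (ccToLp cnt u - reflLp (ccToLp cnt u))
    (ccToLp cnt v - reflLp (ccToLp cnt v))).congr (ae_of_all _ fun n => ?_)
  exact (jump_integrand u v n).symm

theorem integral_jump (u v : C_c(ℤ, ℝ)) :
    ∫ p : ℤ × ℤ, (u p.1 - u p.2) * (v p.1 - v p.2) ∂jump =
      inner ℝ (ccToLp cnt u - reflLp (ccToLp cnt u)) (ccToLp cnt v - reflLp (ccToLp cnt v)) / 2 := by
  rw [jump, integral_smul_measure, integral_map measurable_pair.aemeasurable
    Measurable.of_discrete.aestronglyMeasurable, L2.inner_def]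
  simp only [← jump_integrand]
  simp
  ring

theorem hasNoKilling : form.HasNoKilling := by
  refine ⟨0, jump, ⟨fun _ _ => rfl, fun _ => le_rfl, fun _ _ _ _ _ _ _ => rfl, ?_, ?_, ?_,
    inferInstance, fun u v => integrable_jump u v, fun u v => ?_⟩⟩
  · rw [jump, Measure.map_smul, Measure.map_map measurable_swap measurable_pair]
    congr 1
    have h : (Prod.swap ∘ fun n : ℤ => (n, refl n)) = (fun n : ℤ => (n, refl n)) ∘ refl := by
      ext n <;> simp [refl_refl]
    rw [h, ← Measure.map_map measurable_pair Measurable.of_discrete, measurePreserving_refl.map_eq]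
  · have h : (fun n : ℤ => (n, refl n)) ⁻¹' Set.diagonal ℤ = ∅ := by
      ext n
      simp only [Set.mem_preimage, Set.mem_diagonal_iff, refl, Set.mem_empty_iff_false, iff_false]
      omega
    rw [jump, Measure.smul_apply, Measure.map_apply measurable_pair (MeasurableSet.of_discrete), h]
    simp
  · intro K hK _
    rw [jump, Measure.smul_apply, Measure.map_apply measurable_pair (MeasurableSet.of_discrete)]
    refine ENNReal.mul_lt_top (by simp) (Measure.count_apply_lt_top.2 ?_)
    exact hK.finite_of_discrete.preimage fun m _ n _ h => (Prod.ext_iff.1 h).1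
  · rw [integral_jump]
    simp only [LinearMap.zero_apply, integral_zero_measure, zero_add, add_zero]
    exact energy_eq_half _ _

/-! ### Eigenfunctions and kernel in the example. -/

/-- The indicator function of `{n}`. -/
def single (n : ℤ) : Lp ℝ 2 cnt :=
  indicatorConstLp 2 (measurableSet_singleton n) (by simp) 1

theorem inner_single (n : ℤ) (u : Lp ℝ 2 cnt) : inner ℝ (single n) u = u n := by
  rw [single, L2.inner_indicatorConstLp_one, Measure.restrict_singleton, Measure.count_singleton,
    one_smul, integral_dirac]

theorem single_apply (m n : ℤ) : single m n = if n = m then 1 else 0 := by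
  have h := Measure.ae_count_iff.1 (indicatorConstLp_coeFn (p := 2) (μ := cnt)
    (hs := measurableSet_singleton m) (hμs := by simp) (c := (1 : ℝ))) n
  refine h.trans ?_
  simp [Set.indicator_apply]

theorem reflLp_single (n : ℤ) : reflLp (single n) = single (refl n) := by
  refine ext_inner_right ℝ fun v => ?_
  rw [inner_reflLp, inner_single, inner_single, reflLp_apply]

/-- The normalized odd (`s = -1`) or even (`s = 1`) function supported on `{k, -1 - k}`. -/
def pairLp (s : ℝ) (k : ℕ) : Lp ℝ 2 cnt := (√2)⁻¹ • (single k + s • single (refl k))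

theorem inner_pairLp (s : ℝ) (k : ℕ) (u : Lp ℝ 2 cnt) :
    inner ℝ (pairLp s k) u = (√2)⁻¹ * (u k + s * u (refl k)) := by
  rw [pairLp, real_inner_smul_left, inner_add_left, real_inner_smul_left, inner_single,
    inner_single]

theorem pairLp_apply (s : ℝ) (k : ℕ) (n : ℤ) : pairLp s k n =
    (√2)⁻¹ * ((if n = k then 1 else 0) + s * if n = refl k then 1 else 0) := by
  rw [← inner_single n, real_inner_comm, inner_pairLp, single_apply, single_apply]
  have h : refl k = n ↔ n = refl k := eq_comm
  have h' : (k : ℤ) = n ↔ n = k := eq_comm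
  simp only [h, h']

theorem orthonormal_pairLp {s : ℝ} (hs : s * s = 1) : Orthonormal ℝ (pairLp s) := by
  classical
  rw [orthonormal_iff_ite]
  intro i j
  rw [inner_pairLp, pairLp_apply, pairLp_apply]
  have h1 : (i : ℤ) = j ↔ i = j := Nat.cast_inj
  have h2 : ¬ (i : ℤ) = refl j := by simp only [refl]; omega
  have h3 : ¬ refl i = (j : ℤ) := by simp only [refl]; omega
  have h4 : refl (i : ℤ) = refl j ↔ i = j := refl_injective.eq_iff.trans h1
  have h5 : (√2 : ℝ)⁻¹ * (√2)⁻¹ = 1 / 2 := by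
    rw [← mul_inv, Real.mul_self_sqrt zero_le_two, one_div]
  simp only [h1, h2, h3, h4, if_false]
  split_ifs
  · linear_combination (1 + s * s) * h5 + hs / 2
  · simp

theorem reflLp_pairLp {s : ℝ} (hs : s * s = 1) (k : ℕ) : reflLp (pairLp s k) = s • pairLp s k := by
  rw [pairLp, map_smul, map_add, map_smul, reflLp_single, reflLp_single, refl_refl,
    smul_comm s (√2)⁻¹, smul_add s, smul_smul s s, hs, one_smul, add_comm]

theorem orthonormal_lpOfReal {ι : Type*} {e : ι → Lp ℝ 2 cnt} (he : Orthonormal ℝ e) :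
    Orthonormal ℂ fun j => lpOfReal cnt (e j) := by
  classical
  rw [orthonormal_iff_ite] at he ⊢
  intro i j
  rw [inner_lpOfReal, he]
  split_ifs <;> simp

/-- Here -L = 1 - R is 2 on odd functions and 0 on even ones, and the odd pairs span the odd
functions. -/
theorem hasPurePointSpectrum :
    form.HasPurePointSpectrum (fun _ : ℕ => 2) fun k => lpOfReal cnt (pairLp (-1) k) := by
  obtain ⟨D, hD⟩ := DirichletForm.exists_isDerivative isRegular hasNoKilling
  have hs : (-1 : ℝ) * -1 = 1 := by norm_num
  have horth := orthonormal_lpOfReal (orthonormal_pairLp hs)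
  have heig : ∀ j : ℕ, ∃ h : lpOfReal cnt (pairLp (-1) j) ∈ form.generator.domain,
      form.generator ⟨_, h⟩ = -(2 : ℂ) • lpOfReal cnt (pairLp (-1) j) := fun j => by
    have hmem : (lpOfReal cnt (pairLp (-1) j), lpOfReal cnt (-(2 : ℝ) • pairLp (-1) j)) ∈
        form.generator.graph := by
      rw [hD.graph_generator]
      refine Submodule.subset_span ⟨⟨pairLp (-1) j, trivial⟩, _, fun f => ?_, rfl⟩
      refine (form.symm _ _).trans ((energy_apply _ _).trans ?_)
      rw [reflLp_pairLp hs, real_inner_comm, ← inner_neg_right]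
      congr 1
      module
    have hd := LinearPMap.mem_domain_of_mem_graph hmem
    refine ⟨hd, ?_⟩
    have h1 := LinearPMap.mem_graph_snd_inj _ (form.generator.mem_graph ⟨_, hd⟩) hmem rfl
    rw [h1, map_smul, neg_smul, neg_smul, two_smul, two_smul]
  refine ⟨fun _ => two_pos, horth, fun j => ?_, fun f => ?_⟩
  · obtain ⟨h, he⟩ := heig j
    refine ⟨h, ?_⟩
    rw [he]
    simp
  · obtain ⟨hf, hfin⟩ := hD.inner_grad_generator f
    have hcoef : ∀ j, inner ℂ (lpOfReal cnt (pairLp (-1) j)) (-form.generator f) =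
        2 * inner ℂ (lpOfReal cnt (pairLp (-1) j)) (f : Lp ℂ 2 cnt) := fun j => by
      obtain ⟨h, he⟩ := heig j
      obtain ⟨hg, hgin⟩ := hD.inner_grad_generator ⟨_, h⟩
      have h1 := hgin ⟨_, hf⟩
      have h2 := hfin ⟨_, hg⟩
      rw [he] at h1
      simp only [inner_smul_left, map_neg, Complex.conj_ofNat] at h1
      rw [inner_neg_right, ← inner_conj_symm, ← map_neg, ← h2, inner_conj_symm, h1]
      ring
    -- A vector g orthogonal to all odd pairs is even, so ∂g = 0 and ⟨Lf, g⟩ = -⟨∂f, ∂g⟩ = 0.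
    have hsum := horth.hasSum_inner_of_forall (x := -form.generator f) fun g hg => by
      obtain ⟨u, v, rfl⟩ := exists_eq_lpOfReal_add g
      have heven : ∀ w : Lp ℝ 2 cnt, (∀ j, inner ℝ (pairLp (-1) j) w = 0) →
          D (DirichletForm.FormSpace.ofDomain form ⟨w, trivial⟩) = 0 := fun w hw => by
        have h0 : ∀ k : ℕ, w k = w (refl k) := fun k => by
          have := hw k
          rw [inner_pairLp] at this
          have h2 : (√2 : ℝ)⁻¹ ≠ 0 := by positivity
          have h3 := (mul_eq_zero.1 this).resolve_left h2
          linarith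
        have h1 : reflLp w = w := lp_ext fun n => by
          rw [reflLp_apply]
          rcases le_or_gt 0 n with hn | hn
          · obtain ⟨k, rfl⟩ := Int.eq_ofNat_of_zero_le hn
            exact (h0 k).symm
          · obtain ⟨k, hk⟩ := Int.eq_ofNat_of_zero_le (a := refl n) (by simp only [refl]; omega)
            rw [← refl_refl n, hk, refl_refl]
            exact h0 k
        rw [← inner_self_eq_zero (𝕜 := ℂ), hD.inner_eq]
        refine Complex.ofReal_eq_zero.2 ((energy_apply _ _).trans ?_)
        simp only [h1, sub_self, inner_zero_left]
      have hre : ∀ j, inner ℝ (pairLp (-1) j) u = 0 ∧ inner ℝ (pairLp (-1) j) v = 0 := fun j => by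
        have h := hg j
        simp only [inner_add_right, inner_smul_right, inner_lpOfReal] at h
        exact ⟨by simpa using congrArg Complex.re h, by simpa using congrArg Complex.im h⟩
      obtain ⟨hdom, hgrad⟩ := hD.grad_apply (E := form) ⟨u, trivial⟩ ⟨v, trivial⟩
      rw [heven u fun j => (hre j).1, heven v fun j => (hre j).2, smul_zero, add_zero] at hgrad
      have h2 := hfin ⟨_, hdom⟩
      rw [hgrad, inner_zero_right] at h2
      rw [inner_neg_right, ← inner_conj_symm, ← map_neg, ← h2, map_zero]
    simpa only [hcoef, Complex.ofReal_ofNat] using hsum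

/-- For each k, the even pair at k together with the zero form lies in the kernel, and these even
pairs are orthonormal. -/
theorem not_finiteDimensional_ker_dirac :
    ¬ FiniteDimensional ℂ (LinearMap.ker form.dirac.toFun) := by
  obtain ⟨D, hD⟩ := DirichletForm.exists_isDerivative isRegular hasNoKilling
  intro hfin
  have hs : (1 : ℝ) * 1 = 1 := one_mul 1
  have hker : ∀ k : ℕ, ∃ x : LinearMap.ker form.dirac.toFun,
      ((x : form.dirac.domain) : WithLp 2 (Lp ℂ 2 cnt × form.OneForm)).fst =
        lpOfReal cnt (pairLp 1 k) := fun k => by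
    have h0 : D (DirichletForm.FormSpace.ofDomain form ⟨pairLp 1 k, trivial⟩) = 0 := by
      rw [← inner_self_eq_zero (𝕜 := ℂ), hD.inner_eq]
      refine Complex.ofReal_eq_zero.2 ((energy_apply _ _).trans ?_)
      simp only [reflLp_pairLp hs, one_smul, sub_self, inner_zero_left]
    obtain ⟨hd, hg⟩ := hD.grad_apply (E := form) ⟨pairLp 1 k, trivial⟩ 0
    simp only [Submodule.coe_zero, map_zero, smul_zero, add_zero, h0] at hd hg
    refine ⟨⟨⟨WithLp.toLp 2 (lpOfReal cnt (pairLp 1 k), 0),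
      ⟨hd, form.gradAdjoint.domain.zero_mem⟩⟩, ?_⟩, rfl⟩
    exact congrArg (WithLp.toLp 2) (Prod.ext form.gradAdjoint.map_zero hg)
  choose x hx using hker
  let p : LinearMap.ker form.dirac.toFun →ₗ[ℂ] Lp ℂ 2 cnt :=
    (WithLp.fstL 2 ℂ (Lp ℂ 2 cnt) form.OneForm).toLinearMap ∘ₗ
      form.dirac.domain.subtype ∘ₗ (LinearMap.ker form.dirac.toFun).subtype
  have hli : LinearIndependent ℂ x := by
    refine LinearIndependent.of_comp p ?_
    have : (p ∘ x) = fun k => lpOfReal cnt (pairLp 1 k) := funext hx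
    rw [this]
    exact (orthonormal_lpOfReal (orthonormal_pairLp hs)).linearIndependent
  exact not_finite_iff_infinite.2 (inferInstance : Infinite ℕ) hli.finite_of_isNoetherian

end ReflectionForm

end

theorem mainTheorem8 :
    (∀ (X : Type*) [MetricSpace X] [LocallyCompactSpace X] [TopologicalSpace.SeparableSpace X]
      [MeasurableSpace X] [BorelSpace X] (μ : Measure X) [μ.Regular] [μ.IsOpenPosMeasure]
      (E : DirichletForm μ), E.IsRegular → E.HasNoKilling →
      ∀ (ι : Type*) (lam : ι → ℝ) (φ : ι → Lp ℂ 2 μ), E.HasPurePointSpectrum lam φ →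
      ∃ hφ : ∀ j, φ j ∈ E.grad.domain,
      ∀ v w : ι → WithLp 2 (Lp ℂ 2 μ × E.OneForm),
        (∀ j, v j = (1 / √2 : ℂ) •
          WithLp.toLp 2 (φ j, ((√(lam j))⁻¹ : ℂ) • E.grad ⟨φ j, hφ j⟩)) →
        (∀ j, w j = (1 / √2 : ℂ) •
          WithLp.toLp 2 (φ j, -((√(lam j))⁻¹ : ℂ) • E.grad ⟨φ j, hφ j⟩)) →
        Orthonormal ℂ (Sum.elim v w) ∧
        (∀ j, ∃ h : v j ∈ E.dirac.domain, E.dirac ⟨v j, h⟩ = (√(lam j) : ℂ) • v j) ∧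
        (∀ j, ∃ h : w j ∈ E.dirac.domain, E.dirac ⟨w j, h⟩ = (-√(lam j) : ℂ) • w j) ∧
        ∀ x : E.dirac.domain, ∃ y z : WithLp 2 (Lp ℂ 2 μ × E.OneForm),
          HasSum (fun j => ((√(lam j) : ℂ) *
            inner ℂ (v j) (x : WithLp 2 (Lp ℂ 2 μ × E.OneForm))) • v j) y ∧
          HasSum (fun j => ((√(lam j) : ℂ) *
            inner ℂ (w j) (x : WithLp 2 (Lp ℂ 2 μ × E.OneForm))) • w j) z ∧
          E.dirac x = y - z) ∧
    (∃ (X : Type) (_ : MetricSpace X) (_ : LocallyCompactSpace X)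
      (_ : TopologicalSpace.SeparableSpace X) (_ : MeasurableSpace X) (_ : BorelSpace X)
      (μ : Measure X) (_ : μ.Regular) (_ : μ.IsOpenPosMeasure)
      (E : DirichletForm μ) (lam : ℕ → ℝ) (φ : ℕ → Lp ℂ 2 μ),
      E.IsRegular ∧ E.HasNoKilling ∧ Monotone lam ∧ E.HasPurePointSpectrum lam φ ∧
      ¬ FiniteDimensional ℂ (LinearMap.ker E.dirac.toFun)) := by
  refine ⟨?_, ?_⟩
  · intro X _ _ _ _ _ μ _ _ E hreg hkill ι lam φ hφ
    -- With local compactness this makes X σ-compact, which provides the sequence of cutoffs.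
    have : SecondCountableTopology X := UniformSpace.secondCountable_of_separable X
    obtain ⟨D, hD⟩ := DirichletForm.exists_isDerivative hreg hkill
    have h := hD.isSpectralFamily hφ
    exact ⟨h.mem_domain, fun v w hv hw => DirichletForm.dirac_spectral h hv hw⟩
  · exact ⟨ℤ, inferInstance, inferInstance, inferInstance, inferInstance, inferInstance,
      ReflectionForm.cnt, inferInstance, inferInstance, ReflectionForm.form, fun _ => 2, _,
      ReflectionForm.isRegular, ReflectionForm.hasNoKilling, monotone_const,
      ReflectionForm.hasPurePointSpectrum, ReflectionForm.not_finiteDimensional_ker_dirac⟩
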